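/- Let $\mathcal Z$ be a separable complex Hilbert space (scalar product linear on the right), let $\bigvee^n\mathcal Z$ be its $n$-fold symmetric Hilbert tensor power, $\mathcal S_n$ the orthogonal projection of $\bigotimes^n\mathcal Z$ onto it, and $\mathcal H=\bigoplus_{n\ge 0}\bigvee^n\mathcal Z$ the symmetric Fock space. For $\varepsilon>0$ let $\mathbf N=\varepsilon n$ on $\bigvee^n\mathcal Z$, let $a^*(\xi)f=\sqrt{\varepsilon(n+1)}\,\mathcal S_{n+1}(\xi\otimes f)$ for $f\in\bigvee^n\mathcal Z$, let $a(\xi)$ be its adjoint, $\Phi(\xi)=\frac1{\sqrt2}(a^*(\xi)+a(\xi))$ and $W(\xi)=e^{i\Phi(\xi)}$. For bounded $\tilde b:\bigvee^p\mathcal Z\to\bigvee^q\mathcal Z$ put $b(z)=\langle z^{\otimes q},\tilde b z^{\otimes p}\rangle$ and let $b^{Wick}$ be the operator which on $\bigvee^n\mathcal Z$ is $0$ if $n<p$ and is $\frac{\sqrt{n!\,(n+q-p)!}}{(n-p)!}\,\varepsilon^{\frac{p+q}2}\,\mathcal S_{n+q-p}(\tilde b\otimes I_{\bigvee^{n-p}\mathcal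 Z})$ if $n\ge p$. Let $\mathcal P_{alg}(\mathcal Z)$ be the space of finite sums of such polynomials $b$ (over all $p,q\in\mathbb N$); Wick quantization extends linearly to it. Let $(\varrho_\varepsilon)_{\varepsilon\in(0,\bar\varepsilon)}$ be nonnegative trace class operators on $\mathcal H$ with $\mathrm{Tr}[\varrho_\varepsilon]=1$. A Wigner measure of this family is a Borel probability measure $\mu$ on $\mathcal Z$ such that, along some sequence $\varepsilon_k\to 0$ in $(0,\bar\varepsilon)$, $$\lim_{k\to\infty}\mathrm{Tr}[\varrho_{\varepsilon_k}b^{Weyl}]=\int_{\mathcal Z} b\,d\mu$$ for every $b(z)=\int_F e^{2\pi i\,\mathrm{Re}\langle\xi,z\rangle}\,d\nu(\xi)$ with $\nu$ a bounded complex Borel measure on a finite dimensional subspace $F\subset\mathcal Z$, where $b^{Weyl}=\int_F W(\sqrt2\,\pi\xi)\,d\nu(\xi)$. Assume that $\mu$ is the only Wigner measure of the family, that $\mu\ne\delta_0$, and that condition $$(P)\qquad \lim_{\varepsilon\to0}\mathrm{Tr}[\varrho_\varepsilon b^{Wick}]=\int_{\mathcal Z}b(z)\,d\mu(z)\qquad\text{for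 all } b\in\mathcal P_{alg}(\mathcal Z)$$ holds, both sides being meaningful: every $b\in\mathcal P_{alg}(\mathcal Z)$ is $\mu$-integrable, and for every $k\in\mathbb N$, $\mathrm{Tr}[\mathbf N^{k/2}\varrho_\varepsilon\mathbf N^{k/2}]<\infty$ for all small enough $\varepsilon$. Then for every $p\in\mathbb N$: the integral $\int_{\mathcal Z}|z|^{2p}d\mu(z)$ is finite and positive, so that $$\gamma^{(p)}_0:=\frac1{\int_{\mathcal Z}|z|^{2p}\,d\mu(z)}\int_{\mathcal Z}|z^{\otimes p}\rangle\langle z^{\otimes p}|\,d\mu(z)$$ is a well defined trace class operator on $\bigvee^p\mathcal Z$; for all small enough $\varepsilon$ there is a unique trace class operator $\gamma^{(p)}_\varepsilon$ on $\bigvee^p\mathcal Z$ (the reduced density matrix) with $$\mathrm{Tr}[\gamma^{(p)}_\varepsilon\tilde b]=\frac{\mathrm{Tr}[\varrho_\varepsilon]}{\mathrm{Tr}[\varrho_\varepsilon(|z|^{2p})^{Wick}]}\,\mathrm{Tr}[\varrho_\varepsilon b^{Wick}]\qquad\text{for all bounded }\tilde b \text{ on }\textstyle\bigvee^p\mathcal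 Z,\ b(z)=\langle z^{\otimes p},\tilde bz^{\otimes p}\rangle$$ (the right-hand side being read as $0$ if $\mathrm{Tr}[\varrho_\varepsilon(|z|^{2p})^{Wick}]=0$); and $$\lim_{\varepsilon\to0}\big\|\gamma^{(p)}_\varepsilon-\gamma^{(p)}_0\big\|_{\mathcal L^1(\bigvee^p\mathcal Z)}=0 .$$ -/

import Mathlib

open MeasureTheory Filter Topology
open scoped ENNReal DirectSum InnerProductSpace ComplexConjugate

noncomputable section

namespace MeanField

universe u

/-! ### Hilbert tensor powers -/

section TensorPower

variable (Z : Type u) [NormedAddCommGroup Z] [InnerProductSpace ℂ Z]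

/-- Formal finite linear combinations of product vectors `x₁ ⊗ ⋯ ⊗ xₙ`, to be endowed with the
pre-inner product `⟪x₁ ⊗ ⋯ ⊗ xₙ, y₁ ⊗ ⋯ ⊗ yₙ⟫ = ∏ ⟪xᵢ, yᵢ⟫`. -/
def PreTensor (n : ℕ) : Type u := (Fin n → Z) →₀ ℂ

instance (n : ℕ) : AddCommGroup (PreTensor Z n) :=
  inferInstanceAs (AddCommGroup ((Fin n → Z) →₀ ℂ))

instance (n : ℕ) : Module ℂ (PreTensor Z n) :=
  inferInstanceAs (Module ℂ ((Fin n → Z) →₀ ℂ))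

variable {Z}

/-- The matrix of inner products of product vectors. -/
def prodKernel (n : ℕ) : Matrix (Fin n → Z) (Fin n → Z) ℂ :=
  Matrix.of fun x y => ∏ i, ⟪x i, y i⟫_ℂ

open scoped ComplexOrder in
theorem posSemidef_gram' {X E : Type*} [NormedAddCommGroup E] [InnerProductSpace ℂ E]
    (v : X → E) : (Matrix.gram ℂ v).PosSemidef := by
  refine ⟨Matrix.isHermitian_gram ℂ v, fun f => ?_⟩
  have : (f.sum fun i a => f.sum fun j b => star a * Matrix.gram ℂ v i j * b)
      = ((‖f.sum fun i a => a • v i‖ : ℝ) : ℂ) ^ 2 := by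
    rw [show ((‖f.sum fun i a => a • v i‖ : ℝ) : ℂ) ^ 2 = _ from
      (inner_self_eq_norm_sq_to_K (𝕜 := ℂ) (f.sum fun i a => a • v i)).symm]
    simp only [Finsupp.sum, sum_inner, inner_sum, inner_smul_left, inner_smul_right,
      Matrix.gram_apply, Finset.mul_sum]
    rw [Finset.sum_comm]
    refine Finset.sum_congr rfl fun i _ => Finset.sum_congr rfl fun j _ => ?_
    simp only [RCLike.star_def]
    ring
  rw [this, ← Complex.ofReal_pow]
  exact Complex.zero_le_real.2 (sq_nonneg _)

open scoped ComplexOrder in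
theorem posSemidef_prod {X : Type*} {ι : Type*} (s : Finset ι) (M : ι → Matrix X X ℂ)
    (h : ∀ i ∈ s, (M i).PosSemidef) :
    (Matrix.of fun x y => ∏ i ∈ s, M i x y).PosSemidef := by
  classical
  induction s using Finset.induction_on with
  | empty =>
    have := posSemidef_gram' (fun _ : X => (1 : ℂ))
    have e : (Matrix.of fun x y : X => ∏ i ∈ (∅ : Finset ι), M i x y)
        = Matrix.gram ℂ (fun _ : X => (1 : ℂ)) := by ext; simp
    rw [e]; exact this
  | insert a s ha ih =>
    have h1 := (h a (Finset.mem_insert_self a s)).hadamard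
      (ih fun i hi => h i (Finset.mem_insert_of_mem hi))
    have e : (Matrix.of fun x y : X => ∏ i ∈ insert a s, M i x y)
        = (M a).hadamard (Matrix.of fun x y => ∏ i ∈ s, M i x y) := by
      ext x y
      simp [Finset.prod_insert ha]
    rw [e]; exact h1

open scoped ComplexOrder in
theorem posSemidef_prodKernel (n : ℕ) : (prodKernel (Z := Z) n).PosSemidef := by
  have := posSemidef_prod (Finset.univ : Finset (Fin n))
    (fun i => Matrix.gram ℂ fun x : Fin n → Z => x i) (fun i _ => posSemidef_gram' _)
  exact this

open scoped ComplexOrder in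
/-- The pre-inner product determined by the inner products of product vectors. -/
@[reducible] def preCore (n : ℕ) : PreInnerProductSpace.Core ℂ ((Fin n → Z) →₀ ℂ) where
  inner f g := f.sum fun x a => g.sum fun y b => conj a * b * prodKernel n x y
  conj_inner_symm f g := by
    rw [Finsupp.sum_comm]
    simp only [map_finsuppSum]
    refine Finsupp.sum_congr fun x _ => Finsupp.sum_congr fun y _ => ?_
    simp only [map_mul, Complex.conj_conj, prodKernel, Matrix.of_apply, map_prod, inner_conj_symm]
    ring
  re_inner_nonneg f := by
    have h := (posSemidef_prodKernel (Z := Z) n).2 f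
    have h2 := (Complex.le_def.1 h).1
    simp only [Complex.zero_re] at h2
    refine h2.trans (le_of_eq ?_)
    change Complex.re _ = Complex.re _
    congr 1
    refine Finsupp.sum_congr fun x _ => Finsupp.sum_congr fun y _ => ?_
    simp only [RCLike.star_def]
    ring
  add_left f g k := by
    refine Finsupp.sum_add_index' (fun _ => by simp) fun x a b => ?_
    simp [← Finsupp.sum_add, add_mul]
  smul_left f g r := by
    refine (Finsupp.sum_smul_index (fun _ => by simp)).trans ?_
    simp [Finsupp.mul_sum, ← mul_assoc]

instance (n : ℕ) : PreInnerProductSpace.Core ℂ (PreTensor Z n) := preCore n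

instance (n : ℕ) : SeminormedAddCommGroup (PreTensor Z n) :=
  InnerProductSpace.Core.toSeminormedAddCommGroup (𝕜 := ℂ)

instance (n : ℕ) : InnerProductSpace ℂ (PreTensor Z n) := .ofCore _

variable (Z) in
/-- The Hilbert tensor power `⨂ⁿ Z`: the (separated) completion of the linear combinations of
product vectors. -/
def TensorPow (n : ℕ) : Type u := UniformSpace.Completion (PreTensor Z n)

instance (n : ℕ) : NormedAddCommGroup (TensorPow Z n) :=
  inferInstanceAs (NormedAddCommGroup (UniformSpace.Completion (PreTensor Z n)))

instance (n : ℕ) : InnerProductSpace ℂ (TensorPow Z n) :=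
  inferInstanceAs (InnerProductSpace ℂ (UniformSpace.Completion (PreTensor Z n)))

instance (n : ℕ) : CompleteSpace (TensorPow Z n) :=
  inferInstanceAs (CompleteSpace (UniformSpace.Completion (PreTensor Z n)))

/-- The inclusion of the formal combinations in the completion. -/
def toTensorPow (n : ℕ) : PreTensor Z n →ₗ[ℂ] TensorPow Z n :=
  (UniformSpace.Completion.toComplL (𝕜 := ℂ) (E := PreTensor Z n)).toLinearMap

/-- The product vector `x₁ ⊗ ⋯ ⊗ xₙ`. -/
def tmul {n : ℕ} (x : Fin n → Z) : TensorPow Z n :=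
  toTensorPow n (show PreTensor Z n from Finsupp.single x (1 : ℂ))

theorem inner_tmul {n : ℕ} (x y : Fin n → Z) : ⟪tmul x, tmul y⟫_ℂ = ∏ i, ⟪x i, y i⟫_ℂ := by
  refine (UniformSpace.Completion.inner_coe (𝕜 := ℂ) (E := PreTensor Z n) _ _).trans ?_
  change (Finsupp.sum (Finsupp.single x (1 : ℂ)) fun x a =>
    Finsupp.sum (Finsupp.single y (1 : ℂ)) fun y b => conj a * b * prodKernel n x y) = _
  simp [prodKernel]

/-- The linear map from formal combinations to the tensor power. -/
def tcomb (n : ℕ) : ((Fin n → Z) →₀ ℂ) →ₗ[ℂ] TensorPow Z n := Finsupp.linearCombination ℂ tmul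

theorem tcomb_eq {n : ℕ} (f : PreTensor Z n) : tcomb n f = toTensorPow n f := by
  have h : ∀ f : (Fin n → Z) →₀ ℂ, tcomb n f = toTensorPow n f := by
    intro f
    induction f using Finsupp.induction_linear with
    | zero => rw [map_zero]; exact (map_zero (toTensorPow (Z := Z) n)).symm
    | add f g hf hg => rw [map_add, hf, hg]; exact (map_add (toTensorPow n) _ _).symm
    | single x a =>
      rw [tcomb, Finsupp.linearCombination_single, tmul]
      have : (Finsupp.single x a : (Fin n → Z) →₀ ℂ) = a • Finsupp.single x (1 : ℂ) := by simp
      rw [this]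
      exact (map_smul (toTensorPow (Z := Z) n) a
        (show PreTensor Z n from Finsupp.single x (1 : ℂ))).symm
  exact h f

theorem denseRange_tcomb (n : ℕ) : DenseRange (tcomb (Z := Z) n) := by
  have : (tcomb (Z := Z) n : ((Fin n → Z) →₀ ℂ) → TensorPow Z n)
      = (toTensorPow n : PreTensor Z n → TensorPow Z n) := funext tcomb_eq
  have h : DenseRange (toTensorPow n : PreTensor Z n → TensorPow Z n) :=
    UniformSpace.Completion.denseRange_coe
  rw [← this] at h
  exact h

/-- The continuous linear map on `⨂ⁿ Z` with prescribed values `G x` on product vectors (zero if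
these values do not extend to a bounded linear map). -/
def tlift {E : Type*} [NormedAddCommGroup E] [InnerProductSpace ℂ E] [CompleteSpace E]
    {n : ℕ} (G : (Fin n → Z) → E) : TensorPow Z n →L[ℂ] E :=
  (Finsupp.linearCombination ℂ G).extendOfNorm (tcomb n)

theorem norm_comb_sq {E : Type*} [NormedAddCommGroup E] [InnerProductSpace ℂ E]
    {X : Type*} (G : X → E) (f : X →₀ ℂ) :
    ((‖Finsupp.linearCombination ℂ G f‖ ^ 2 : ℝ) : ℂ)
      = f.sum fun x a => f.sum fun y b => conj a * b * ⟪G x, G y⟫_ℂ := by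
  rw [Complex.ofReal_pow, Finsupp.linearCombination_apply,
    show ((‖f.sum fun i a => a • G i‖ : ℝ) : ℂ) ^ 2 = _ from
      (inner_self_eq_norm_sq_to_K (𝕜 := ℂ) (f.sum fun i a => a • G i)).symm]
  simp only [Finsupp.sum, sum_inner, inner_sum, inner_smul_left, inner_smul_right, Finset.mul_sum]
  rw [Finset.sum_comm]
  refine Finset.sum_congr rfl fun i _ => Finset.sum_congr rfl fun j _ => ?_
  ring

open scoped ComplexOrder in
theorem tlift_bound {E : Type*} [NormedAddCommGroup E] [InnerProductSpace ℂ E]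
    {n : ℕ} (G : (Fin n → Z) → E) (C : ℝ) (hC : 0 ≤ C)
    (h : (Matrix.of fun x y : Fin n → Z =>
      (C : ℂ) ^ 2 * ∏ i, ⟪x i, y i⟫_ℂ - ⟪G x, G y⟫_ℂ).PosSemidef) (f : (Fin n → Z) →₀ ℂ) :
    ‖Finsupp.linearCombination ℂ G f‖ ≤ C * ‖tcomb n f‖ := by
  have h2 := h.2 f
  have h3 : (f.sum fun x a => f.sum fun y b => star a * (Matrix.of fun x y : Fin n → Z =>
      (C : ℂ) ^ 2 * ∏ i, ⟪x i, y i⟫_ℂ - ⟪G x, G y⟫_ℂ) x y * b)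
      = (((C * ‖tcomb n f‖) ^ 2 - ‖Finsupp.linearCombination ℂ G f‖ ^ 2 : ℝ) : ℂ) := by
    rw [Complex.ofReal_sub, norm_comb_sq, mul_pow, Complex.ofReal_mul]
    have := norm_comb_sq (tmul (Z := Z) (n := n)) f
    rw [show (Finsupp.linearCombination ℂ tmul) f = tcomb n f from rfl] at this
    rw [this]
    simp only [Finsupp.sum, Finset.mul_sum, ← Finset.sum_sub_distrib, inner_tmul,
      Matrix.of_apply, RCLike.star_def, Complex.ofReal_pow]
    refine Finset.sum_congr rfl fun i _ => Finset.sum_congr rfl fun j _ => ?_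
    ring
  rw [h3] at h2
  have h4 : (0 : ℝ) ≤ (C * ‖tcomb n f‖) ^ 2 - ‖Finsupp.linearCombination ℂ G f‖ ^ 2 := by
    exact_mod_cast h2
  exact abs_le_of_sq_le_sq' (by linarith) (by positivity) |>.2

theorem tlift_tmul {E : Type*} [NormedAddCommGroup E] [InnerProductSpace ℂ E] [CompleteSpace E]
    {n : ℕ} (G : (Fin n → Z) → E)
    (h : ∃ C, ∀ f, ‖Finsupp.linearCombination ℂ G f‖ ≤ C * ‖tcomb n f‖) (x : Fin n → Z) :
    tlift G (tmul x) = G x := by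
  have := LinearMap.extendOfNorm_eq (denseRange_tcomb n) h (Finsupp.single x 1)
  simpa [tcomb, tlift] using this

open scoped ComplexOrder in
theorem bound_of_inner {E : Type*} [NormedAddCommGroup E] [InnerProductSpace ℂ E]
    {n : ℕ} (G : (Fin n → Z) → E) (C : ℝ) (hC : 0 ≤ C)
    (h : ∀ x y, ⟪G x, G y⟫_ℂ = (C : ℂ) ^ 2 * ∏ i, ⟪x i, y i⟫_ℂ) :
    ∃ C, ∀ f, ‖Finsupp.linearCombination ℂ G f‖ ≤ C * ‖tcomb n f‖ := by
  refine ⟨C, tlift_bound G C hC ?_⟩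
  have e : (Matrix.of fun x y : Fin n → Z =>
      (C : ℂ) ^ 2 * ∏ i, ⟪x i, y i⟫_ℂ - ⟪G x, G y⟫_ℂ) = 0 := by
    ext x y
    simp [h]
  rw [e]; exact Matrix.PosSemidef.zero

theorem tensor_induction {n : ℕ} {P : TensorPow Z n → Prop} (hc : IsClosed {f | P f})
    (h0 : P 0) (hadd : ∀ f g, P f → P g → P (f + g))
    (hsmul : ∀ (a : ℂ) x, P (a • tmul x)) (f : TensorPow Z n) : P f := by
  refine (denseRange_tcomb n).induction_on (p := P) f hc fun g => ?_
  induction g using Finsupp.induction_linear with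
  | zero => simpa using h0
  | add f g hf hg => rw [map_add]; exact hadd _ _ hf hg
  | single x a => simpa [tcomb] using hsmul a x

/-! ### Permutations, insertion of product vectors, `A ⊗ I` -/

/-- The unitary permuting the tensor factors. -/
def permOp {n : ℕ} (σ : Equiv.Perm (Fin n)) : TensorPow Z n →L[ℂ] TensorPow Z n :=
  tlift fun x => tmul (x ∘ σ)

theorem permOp_tmul {n : ℕ} (σ : Equiv.Perm (Fin n)) (x : Fin n → Z) :
    permOp σ (tmul x) = tmul (x ∘ σ) := by
  refine tlift_tmul _ (bound_of_inner _ 1 zero_le_one fun x y => ?_) x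
  rw [inner_tmul]
  simpa using Equiv.prod_comp σ fun i => ⟪x i, y i⟫_ℂ

/-- The map `f ↦ f ⊗ y₁ ⊗ ⋯ ⊗ yₘ` from `⨂ᵖ Z` to `⨂ᵖ⁺ᵐ Z`. -/
def insertR {p m : ℕ} (y : Fin m → Z) : TensorPow Z p →L[ℂ] TensorPow Z (p + m) :=
  tlift fun x => tmul (Fin.append x y)

theorem inner_tmul_append {p m : ℕ} (x x' : Fin p → Z) (y y' : Fin m → Z) :
    ⟪tmul (Fin.append x y), tmul (Fin.append x' y')⟫_ℂ
      = (∏ i, ⟪x i, x' i⟫_ℂ) * ∏ i, ⟪y i, y' i⟫_ℂ := by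
  rw [inner_tmul, Fin.prod_univ_add]
  simp

theorem insertR_tmul {p m : ℕ} (y : Fin m → Z) (x : Fin p → Z) :
    insertR y (tmul x) = tmul (Fin.append x y) := by
  refine tlift_tmul _ (bound_of_inner _ (∏ i, ‖y i‖) (by positivity) fun x x' => ?_) x
  rw [inner_tmul_append, mul_comm]
  simp [inner_self_eq_norm_sq_to_K, Finset.prod_pow]

theorem inner_insertR {p m : ℕ} (y y' : Fin m → Z) (f g : TensorPow Z p) :
    ⟪insertR y f, insertR y' g⟫_ℂ = ⟪f, g⟫_ℂ * ∏ i, ⟪y i, y' i⟫_ℂ := by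
  induction f using tensor_induction with
  | hc => exact isClosed_eq (by fun_prop) (by fun_prop)
  | h0 => simp
  | hadd f f' hf hf' => simp only [map_add, inner_add_left, hf, hf', add_mul]
  | hsmul a x =>
    induction g using tensor_induction with
    | hc => exact isClosed_eq (by fun_prop) (by fun_prop)
    | h0 => simp
    | hadd f f' hf hf' => simp only [map_add, inner_add_right, hf, hf', add_mul]
    | hsmul b x' =>
      simp only [map_smul, insertR_tmul, inner_smul_left, inner_smul_right]
      rw [inner_tmul_append, inner_tmul]
      ring

/-- The first `p` entries of a `(p + m)`-tuple. -/
def leftPart {p m n : ℕ} (h : p + m = n) (x : Fin n → Z) : Fin p → Z :=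
  fun i => x (Fin.cast h (Fin.castAdd m i))

/-- The last `m` entries of a `(p + m)`-tuple. -/
def rightPart {p m n : ℕ} (h : p + m = n) (x : Fin n → Z) : Fin m → Z :=
  fun i => x (Fin.cast h (Fin.natAdd p i))

/-- The operator `A ⊗ I : ⨂ⁿ Z → ⨂^(q+m) Z` for `A : ⨂ᵖ Z → ⨂^q Z` and `n = p + m`. -/
def tensorId {p q m n : ℕ} (h : p + m = n) (A : TensorPow Z p →L[ℂ] TensorPow Z q) :
    TensorPow Z n →L[ℂ] TensorPow Z (q + m) :=
  tlift fun x => insertR (rightPart h x) (A (tmul (leftPart h x)))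

open scoped ComplexOrder in
theorem tensorId_tmul {p q m n : ℕ} (h : p + m = n) (A : TensorPow Z p →L[ℂ] TensorPow Z q)
    (x : Fin n → Z) :
    tensorId h A (tmul x) = insertR (rightPart h x) (A (tmul (leftPart h x))) := by
  subst h
  refine tlift_tmul _ ⟨‖A‖, tlift_bound _ ‖A‖ (norm_nonneg A) ?_⟩ x
  have h1 := Matrix.posSemidef_opNorm_smul_gram_sub_gram (𝕜 := ℂ)
    (fun x : Fin (p + m) → Z => tmul (leftPart rfl x)) A
  have h2 := (posSemidef_prodKernel (Z := Z) m).submatrix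
    (fun x : Fin (p + m) → Z => rightPart rfl x)
  have e : (Matrix.of fun x y : Fin (p + m) → Z => ((‖A‖ : ℝ) : ℂ) ^ 2 * ∏ i, ⟪x i, y i⟫_ℂ -
      ⟪insertR (rightPart rfl x) (A (tmul (leftPart rfl x))),
        insertR (rightPart rfl y) (A (tmul (leftPart rfl y)))⟫_ℂ) = Matrix.hadamard
      (‖A‖ ^ 2 • Matrix.gram ℂ (fun x : Fin (p + m) → Z => tmul (leftPart rfl x))
        - Matrix.gram ℂ (A ∘ fun x : Fin (p + m) → Z => tmul (leftPart rfl x)))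
      ((prodKernel m).submatrix (fun x : Fin (p + m) → Z => rightPart rfl x)
        (fun x : Fin (p + m) → Z => rightPart rfl x)) := ?_
  · rw [e]; exact h1.hadamard h2
  ext x y
  simp only [Matrix.of_apply, Matrix.hadamard_apply, Matrix.sub_apply, Matrix.smul_apply,
    Matrix.gram_apply, Matrix.submatrix_apply, prodKernel, inner_insertR, inner_tmul,
    Function.comp_apply, Fin.prod_univ_add, leftPart, rightPart, Fin.cast_eq_self,
    Complex.real_smul, Complex.ofReal_pow]
  ring

/-! ### Symmetric tensors -/

variable (Z) in
/-- The symmetric Hilbert tensor power `⋁ⁿ Z`, the subspace of permutation invariant tensors. -/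
def SymPow (n : ℕ) : Submodule ℂ (TensorPow Z n) :=
  ⨅ σ : Equiv.Perm (Fin n), LinearMap.eqLocus (permOp σ).toLinearMap LinearMap.id

theorem mem_SymPow {n : ℕ} {f : TensorPow Z n} :
    f ∈ SymPow Z n ↔ ∀ σ : Equiv.Perm (Fin n), permOp σ f = f := by
  simp [SymPow, Submodule.mem_iInf]

theorem isClosed_SymPow (n : ℕ) : IsClosed (SymPow Z n : Set (TensorPow Z n)) := by
  have : (SymPow Z n : Set (TensorPow Z n))
      = ⋂ σ : Equiv.Perm (Fin n), {f | permOp σ f = f} := by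
    ext f
    simp [mem_SymPow]
  rw [this]
  exact isClosed_iInter fun σ => isClosed_eq (permOp σ).continuous continuous_id

instance (n : ℕ) : CompleteSpace (SymPow Z n) := (isClosed_SymPow n).completeSpace_coe

/-- The orthogonal projection `S_n` of `⨂ⁿ Z` onto `⋁ⁿ Z`. -/
def symProj (n : ℕ) : TensorPow Z n →L[ℂ] SymPow Z n := (SymPow Z n).orthogonalProjectionOnto

/-- The vector `z^{⊗n}` of `⋁ⁿ Z`. -/
def tpow (n : ℕ) (z : Z) : SymPow Z n :=
  ⟨tmul fun _ => z, mem_SymPow.2 fun σ => permOp_tmul σ _⟩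

/-- The operator `A ∨ I : ⋁ⁿ Z → ⋁^(q+m) Z`, `n = p + m`, that is
`S_{q+m} ∘ (A ⊗ I) ∘ S_{p+m}` restricted to `⋁ⁿ Z`. -/
def symTensorId {p q m n : ℕ} (h : p + m = n) (A : SymPow Z p →L[ℂ] SymPow Z q) :
    SymPow Z n →L[ℂ] SymPow Z (q + m) :=
  symProj (q + m) ∘L tensorId h ((SymPow Z q).subtypeL ∘L A ∘L symProj p) ∘L (SymPow Z n).subtypeL

/-! ### The symmetric Fock space -/

variable (Z) in
/-- The symmetric Fock space, the Hilbert direct sum of the `⋁ⁿ Z`. -/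
abbrev Fock : Type u := lp (fun n => SymPow Z n) 2

variable (Z) in
/-- The space of vectors with finitely many particles, the algebraic direct sum of the `⋁ⁿ Z`. -/
abbrev FockFin : Type u := ⨁ n, SymPow Z n

/-- The inclusion of the finite particle vectors in the Fock space. -/
def toFock : FockFin Z →ₗ[ℂ] Fock Z :=
  DirectSum.toModule ℂ ℕ (Fock Z) fun n =>
    lp.lsingle (𝕜 := ℂ) (E := fun n => SymPow Z n) 2 n

/-- Creation operator `⋁ⁿ Z → ⋁ⁿ⁺¹ Z`, `f ↦ √(ε (n + 1)) S_{n+1} (ξ ⊗ f)`. As `S_{n+1}` is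
permutation invariant, `ξ` may be inserted as the last factor. -/
def creationBlock (ε : ℝ) (ξ : Z) (n : ℕ) : SymPow Z n →L[ℂ] SymPow Z (n + 1) :=
  (√(ε * (n + 1)) : ℂ) •
    (symProj (n + 1) ∘L insertR (fun _ : Fin 1 => ξ) ∘L (SymPow Z n).subtypeL)

/-- The creation operator `a*(ξ)` on finite particle vectors. -/
def creation (ε : ℝ) (ξ : Z) : FockFin Z →ₗ[ℂ] FockFin Z :=
  DirectSum.toModule ℂ ℕ (FockFin Z) fun n =>
    DirectSum.lof ℂ ℕ (fun n => SymPow Z n) (n + 1) ∘ₗ (creationBlock ε ξ n).toLinearMap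

/-- The annihilation operator `a(ξ)` on finite particle vectors. Its block
`⋁ⁿ⁺¹ Z → ⋁ⁿ Z`, `√(ε (n + 1)) ⟨ξ| ⊗ I`, is the adjoint of the block of `a*(ξ)`. -/
def annihilation (ε : ℝ) (ξ : Z) : FockFin Z →ₗ[ℂ] FockFin Z :=
  DirectSum.toModule ℂ ℕ (FockFin Z) fun n =>
    match n with
    | 0 => 0
    | n + 1 => DirectSum.lof ℂ ℕ (fun n => SymPow Z n) n ∘ₗ
        (ContinuousLinearMap.adjoint (creationBlock ε ξ n)).toLinearMap

/-- The field operator `Φ(ξ) = (a*(ξ) + a(ξ)) / √2` on finite particle vectors. -/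
def field (ε : ℝ) (ξ : Z) : FockFin Z →ₗ[ℂ] FockFin Z :=
  ((√2 : ℝ) : ℂ)⁻¹ • (creation ε ξ + annihilation ε ξ)

/-- The Weyl operator `W(ξ) = exp (i Φ(ξ))`: the bounded operator given by the (convergent)
exponential series on finite particle vectors, which are dense and analytic for `Φ(ξ)`. -/
def weyl (ε : ℝ) (ξ : Z) : Fock Z →L[ℂ] Fock Z :=
  Classical.epsilon fun U => ∀ ψ : FockFin Z,
    HasSum (fun k : ℕ => (Complex.I ^ k / (k.factorial : ℂ)) • toFock ((field ε ξ ^ k) ψ))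
      (U (toFock ψ))

/-! ### Wick quantization -/

/-- The Wick monomial on finite particle vectors, with kernel `b : ⋁ᵖ Z → ⋁^q Z`. It acts on
`⋁ⁿ Z`, `n ≥ p`, as `√(n! (n+q-p)!) / (n-p)! ε^((p+q)/2) (b ∨ I)`. -/
def wickMonomial (ε : ℝ) {p q : ℕ} (b : SymPow Z p →L[ℂ] SymPow Z q) :
    FockFin Z →ₗ[ℂ] FockFin Z :=
  DirectSum.toModule ℂ ℕ (FockFin Z) fun n =>
    if h : p ≤ n then
      ((√(n.factorial * (q + (n - p)).factorial) / (n - p).factorial * √ε ^ (p + q) : ℝ) : ℂ) •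
        (DirectSum.lof ℂ ℕ (fun n => SymPow Z n) (q + (n - p)) ∘ₗ
          (symTensorId (Nat.add_sub_cancel' h) b).toLinearMap)
    else 0

variable (Z) in
/-- The elements of `P_alg(Z)`: finite sums of homogeneous polynomials
`z ↦ ⟨z^{⊗q}, b z^{⊗p}⟩` with bounded kernels `b : ⋁ᵖ Z → ⋁^q Z`. -/
structure PolyAlg where
  /-- the bidegrees `(p, q)` that occur -/
  degrees : Finset (ℕ × ℕ)
  /-- the kernels -/
  kernel : ∀ p q : ℕ, SymPow Z p →L[ℂ] SymPow Z q

/-- The polynomial function. -/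
def PolyAlg.eval (b : PolyAlg Z) (z : Z) : ℂ :=
  ∑ d ∈ b.degrees, ⟪tpow d.2 z, b.kernel d.1 d.2 (tpow d.1 z)⟫_ℂ

/-- The Wick quantization. -/
def PolyAlg.wick (ε : ℝ) (b : PolyAlg Z) : FockFin Z →ₗ[ℂ] FockFin Z :=
  ∑ d ∈ b.degrees, wickMonomial ε (b.kernel d.1 d.2)

end TensorPower

/-! ### Traces -/

section Trace

variable (E : Type*) [NormedAddCommGroup E] [InnerProductSpace ℂ E] [CompleteSpace E]

/-- Index set of a chosen Hilbert basis. -/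
def BasisIndex : Type _ := (exists_hilbertBasis ℂ E).choose

/-- A chosen Hilbert basis. -/
def hbasis : HilbertBasis (BasisIndex E) ℂ E := (exists_hilbertBasis ℂ E).choose_spec.choose

variable {E}

/-- The trace of a (trace class) operator. -/
def trace (T : E →L[ℂ] E) : ℂ := ∑' i, ⟪hbasis E i, T (hbasis E i)⟫_ℂ

/-- The trace norm `Tr |T|`, with `|T| = √(T* T)`. -/
def traceNorm (T : E →L[ℂ] E) : ℝ≥0∞ :=
  ∑' i, ENNReal.ofReal (⟪hbasis E i, CFC.abs T (hbasis E i)⟫_ℂ).re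

/-- `T` is trace class. -/
def IsTraceClass (T : E →L[ℂ] E) : Prop := traceNorm T < ∞

end Trace

section States

variable {Z : Type u} [NormedAddCommGroup Z] [InnerProductSpace ℂ Z]

/-- An orthonormal basis of the Fock space made of vectors in the spaces `⋁ⁿ Z`. -/
def fockBasis (i : Σ n, BasisIndex (SymPow Z n)) : FockFin Z :=
  DirectSum.lof ℂ ℕ (fun n => SymPow Z n) i.1 (hbasis (SymPow Z i.1) i.2)

/-- The trace `Tr[ρ B]` for an operator `B` defined on finite particle vectors, computed in an
orthonormal basis contained in the domain of `B`. -/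
def traceMul (ρ : Fock Z →L[ℂ] Fock Z) (B : FockFin Z →ₗ[ℂ] FockFin Z) : ℂ :=
  ∑' i, ⟪toFock (fockBasis i), ρ (toFock (B (fockBasis i)))⟫_ℂ

/-- The moment `Tr[N^(k/2) ρ N^(k/2)]` of a nonnegative operator `ρ`, where the number operator
`N` is multiplication by `ε n` on `⋁ⁿ Z`. -/
def numberMoment (ε : ℝ) (k : ℕ) (ρ : Fock Z →L[ℂ] Fock Z) : ℝ≥0∞ :=
  ∑' i : Σ n, BasisIndex (SymPow Z n), ENNReal.ofReal ((ε * i.1) ^ k *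
    (⟪toFock (fockBasis i), ρ (toFock (fockBasis i))⟫_ℂ).re)

/-! ### Reduced density matrices -/

/-- `γ` is a reduced density matrix of order `p` of `ρ`: a trace class operator on `⋁ᵖ Z` with
`Tr[γ b] = Tr[ρ] / Tr[ρ (|z|^{2p})^Wick] * Tr[ρ b^Wick]` for all bounded `b`, where the right-hand
side is read as zero if `Tr[ρ (|z|^{2p})^Wick] = 0`. The polynomial `|z|^{2p}` has the
identity as kernel. -/
def IsReducedDensity (ε : ℝ) (ρ : Fock Z →L[ℂ] Fock Z) (p : ℕ)
    (γ : SymPow Z p →L[ℂ] SymPow Z p) : Prop :=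
  IsTraceClass γ ∧ ∀ b : SymPow Z p →L[ℂ] SymPow Z p,
    trace (γ ∘L b)
      = trace ρ / traceMul ρ (wickMonomial ε (ContinuousLinearMap.id ℂ (SymPow Z p)))
        * traceMul ρ (wickMonomial ε b)

/-- The reduced density matrix of order `p`. -/
def reducedDensity (ε : ℝ) (ρ : Fock Z →L[ℂ] Fock Z) (p : ℕ) : SymPow Z p →L[ℂ] SymPow Z p :=
  Classical.epsilon (IsReducedDensity ε ρ p)

/-! ### Wigner measures -/

variable [MeasurableSpace Z]

/-- The cylindrical function `z ↦ ∫ e^{2πi Re⟨ξ, z⟩} h(ξ) dν(ξ)`, inverse Fourier transform of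
the complex measure `h dν` on the finite dimensional space `F`. -/
def invFourier (F : Submodule ℂ Z) (ν : Measure F) (h : F → ℂ) (z : Z) : ℂ :=
  ∫ ξ : F, h ξ * Complex.exp (2 * Real.pi * Complex.I * ((⟪(ξ : Z), z⟫_ℂ).re : ℂ)) ∂ν

/-- The Weyl quantization `∫ W(√2 π ξ) h(ξ) dν(ξ)` (weak integral) of `invFourier F ν h`. -/
def weylQuant (ε : ℝ) (F : Submodule ℂ Z) (ν : Measure F) (h : F → ℂ) : Fock Z →L[ℂ] Fock Z :=
  Classical.epsilon fun B => ∀ φ ψ : Fock Z,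
    ⟪φ, B ψ⟫_ℂ = ∫ ξ : F, h ξ * ⟪φ, weyl ε (((√2 * Real.pi : ℝ) : ℂ) • (ξ : Z)) ψ⟫_ℂ ∂ν

/-- The set of Wigner measures of the family `(ρ ε)`, `ε ∈ (0, ε₀)`: the Borel probability
measures `μ` such that along some sequence `ε_n → 0`, `Tr[ρ_{ε_n} b^Weyl] → ∫ b dμ` for all
inverse Fourier transforms `b` of bounded complex measures on finite dimensional subspaces. -/
def wignerMeasures (ε₀ : ℝ) (ρ : ℝ → Fock Z →L[ℂ] Fock Z) : Set (Measure Z) :=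
  {μ | IsProbabilityMeasure μ ∧ ∃ s : ℕ → ℝ, (∀ n, s n ∈ Set.Ioo 0 ε₀) ∧ Tendsto s atTop (𝓝 0) ∧
    ∀ (F : Submodule ℂ Z) (ν : Measure F) (h : F → ℂ), FiniteDimensional ℂ F →
      IsFiniteMeasure ν → Integrable h ν →
      Tendsto (fun n => trace (ρ (s n) ∘L weylQuant (s n) F ν h)) atTop
        (𝓝 (∫ z, invFourier F ν h z ∂μ))}

/-- Condition `(P)`: `Tr[ρ_ε b^Wick] → ∫ b dμ` as `ε → 0` for every polynomial `b ∈ P_alg(Z)`.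
The first two fields say that both sides are meaningful. -/
structure ConditionP (ρ : ℝ → Fock Z →L[ℂ] Fock Z) (μ : Measure Z) : Prop where
  moments : ∀ k : ℕ, ∀ᶠ ε in 𝓝[>] (0 : ℝ), numberMoment ε k (ρ ε) < ∞
  integrable : ∀ b : PolyAlg Z, Integrable b.eval μ
  tendsto : ∀ b : PolyAlg Z,
    Tendsto (fun ε => traceMul (ρ ε) (b.wick ε)) (𝓝[>] (0 : ℝ)) (𝓝 (∫ z, b.eval z ∂μ))

/-- The operator `(∫ |z|^{2p} dμ)⁻¹ ∫ |z^{⊗p}⟩⟨z^{⊗p}| dμ(z)` on `⋁ᵖ Z`. -/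
def limitDensity (μ : Measure Z) (p : ℕ) : SymPow Z p →L[ℂ] SymPow Z p :=
  ((∫ z, ‖z‖ ^ (2 * p) ∂μ)⁻¹ : ℝ) •
    ∫ z, InnerProductSpace.rankOne ℂ (tpow p z) (tpow p z) ∂μ

end States

end MeanField

end

/-! For fixed `p`, the functional `b ↦ Tr[ρ_ε b^Wick]` on kernels `b : ⋁ᵖ Z → ⋁ᵖ Z` is positive and
normal, so it is `b ↦ Tr[γ b]` for a positive trace class `γ` (`exists_density`,
`exists_density_wick`). Normality holds because `ρ_ε` can be split as a product of square roots, one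
moved to each side of `b ∨ I`; the resulting series is dominated by the `p`-th moment of the number
operator. Dividing by the value at the identity gives the reduced density matrix, and it is unique
since rank-one kernels read off all its matrix elements. The functional `b ↦ ∫ ⟪z^{⊗p}, b z^{⊗p}⟫
dμ` is represented in the same way by the integral of the projectors (`integral_rankOne`).

Condition `(P)` in bidegree `(p, p)` is pointwise convergence of the first functionals to the
second. The identity kernel shows that the normalizations converge to `∫ |z|^{2p} dμ`, which is
nonzero as `μ ≠ δ₀`, and hence that the traces of the normalized operators converge. Rank-one
kernels give convergence of matrix elements.

For positive operators, these two facts force convergence in trace norm (`tendsto_traceNorm_sub`): a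
finite block that carries almost all the trace of the limit also carries almost all the trace of the
nearby operators, and in a finite block there are only finitely many matrix elements to compare. -/

noncomputable section

namespace MeanField

/-! ### Hilbert-Schmidt sums and their invariance under adjoints -/

section HilbertSchmidt

variable {E F : Type*} [NormedAddCommGroup E] [InnerProductSpace ℂ E]
  [NormedAddCommGroup F] [InnerProductSpace ℂ F]

theorem hasSum_norm_inner_sq {ι : Type*} (e : HilbertBasis ι ℂ E) (x : E) :
    HasSum (fun i => ‖⟪e i, x⟫_ℂ‖ ^ 2) (‖x‖ ^ 2) := by
  have h := (e.hasSum_inner_mul_inner x x).mapL Complex.reCLM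
  have h2 : Complex.reCLM ⟪x, x⟫_ℂ = ‖x‖ ^ 2 := by
    rw [inner_self_eq_norm_sq_to_K]
    norm_cast
  rw [h2] at h
  refine h.congr_fun ?_ |> fun h => h
  intro i
  rw [← inner_conj_symm x (e i), Complex.conj_mul']
  norm_cast

theorem tsum_enorm_inner_sq {ι : Type*} (e : HilbertBasis ι ℂ E) (x : E) :
    ∑' i, ‖⟪e i, x⟫_ℂ‖ₑ ^ 2 = ‖x‖ₑ ^ 2 := by
  have h := hasSum_norm_inner_sq e x
  have h1 := ENNReal.ofReal_tsum_of_nonneg (fun i => by positivity) h.summable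
  rw [h.tsum_eq] at h1
  simpa [ENNReal.ofReal_pow, ofReal_norm] using h1.symm

/-- Parseval turns both sides into the same double sum of squared matrix elements. In `ℝ≥0∞` the
interchange needs no summability. -/
theorem tsum_enorm_adjoint [CompleteSpace E] [CompleteSpace F] {ι κ : Type*} (e : HilbertBasis ι ℂ E) (f : HilbertBasis κ ℂ F)
    (A : E →L[ℂ] F) :
    ∑' j, ‖ContinuousLinearMap.adjoint A (f j)‖ₑ ^ 2 = ∑' i, ‖A (e i)‖ₑ ^ 2 := by
  simp_rw [← tsum_enorm_inner_sq e, ← tsum_enorm_inner_sq f]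
  rw [ENNReal.tsum_comm]
  refine tsum_congr fun i => tsum_congr fun j => ?_
  rw [ContinuousLinearMap.adjoint_inner_right, ← inner_conj_symm, enorm_eq_nnnorm,
    enorm_eq_nnnorm, RCLike.nnnorm_conj]

theorem summable_sq_iff_tsum_enorm {ι : Type*} {F : Type*} [NormedAddCommGroup F] (g : ι → F) :
    (Summable fun i => ‖g i‖ ^ 2) ↔ ∑' i, ‖g i‖ₑ ^ 2 ≠ ∞ := by
  have : ∀ i, ‖g i‖ₑ ^ 2 = ENNReal.ofReal (‖g i‖ ^ 2) := fun i => by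
    rw [ENNReal.ofReal_pow (norm_nonneg _), ofReal_norm]
  simp_rw [this]
  refine ⟨fun h => ?_, fun h => ?_⟩
  · rw [← ENNReal.ofReal_tsum_of_nonneg (fun i => by positivity) h]
    exact ENNReal.ofReal_ne_top
  · refine (ENNReal.summable_toReal h).congr fun i => ?_
    rw [ENNReal.toReal_ofReal (by positivity)]

theorem tsum_enorm_sq_eq {ι : Type*} {F : Type*} [NormedAddCommGroup F] (g : ι → F) (h : Summable fun i => ‖g i‖ ^ 2) :
    ∑' i, ‖g i‖ₑ ^ 2 = ENNReal.ofReal (∑' i, ‖g i‖ ^ 2) := by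
  have : ∀ i, ‖g i‖ₑ ^ 2 = ENNReal.ofReal (‖g i‖ ^ 2) := fun i => by
    rw [ENNReal.ofReal_pow (norm_nonneg _), ofReal_norm]
  simp_rw [this]
  rw [← ENNReal.ofReal_tsum_of_nonneg (fun i => by positivity) h]

theorem hasSum_norm_sq_adjoint [CompleteSpace E] [CompleteSpace F] {ι κ : Type*} (e : HilbertBasis ι ℂ E) (f : HilbertBasis κ ℂ F)
    (A : E →L[ℂ] F) {t : ℝ} (h : HasSum (fun i => ‖A (e i)‖ ^ 2) t) :
    HasSum (fun j => ‖ContinuousLinearMap.adjoint A (f j)‖ ^ 2) t := by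
  have h1 := tsum_enorm_adjoint e f A
  have hs : Summable fun j => ‖ContinuousLinearMap.adjoint A (f j)‖ ^ 2 := by
    rw [summable_sq_iff_tsum_enorm, h1, ← summable_sq_iff_tsum_enorm]
    exact h.summable
  rw [tsum_enorm_sq_eq _ hs, tsum_enorm_sq_eq _ h.summable, h.tsum_eq] at h1
  have h2 : ∑' j, ‖ContinuousLinearMap.adjoint A (f j)‖ ^ 2 = t :=
    (ENNReal.ofReal_eq_ofReal_iff (tsum_nonneg fun _ => by positivity)
      (h.nonneg fun _ => by positivity)).1 h1
  exact h2 ▸ hs.hasSum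

theorem summable_inner_of_sq {ι : Type*} {F : Type*} [NormedAddCommGroup F] {u v : ι → F} (hu : Summable fun i => ‖u i‖ ^ 2)
    (hv : Summable fun i => ‖v i‖ ^ 2) : Summable fun i => ‖u i‖ * ‖v i‖ := by
  refine Summable.of_nonneg_of_le (fun i => by positivity) (fun i => ?_) (hu.add hv)
  nlinarith [sq_nonneg (‖u i‖ - ‖v i‖), sq_nonneg (‖u i‖), sq_nonneg (‖v i‖)]

theorem summable_norm_inner_sq {ι κ : Type*} (f : HilbertBasis κ ℂ F) {u : ι → F}
    (hu : Summable fun i => ‖u i‖ ^ 2) :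
    Summable fun p : ι × κ => ‖⟪f p.2, u p.1⟫_ℂ‖ ^ 2 := by
  rw [summable_prod_of_nonneg fun _ => by positivity]
  refine ⟨fun i => (hasSum_norm_inner_sq f (u i)).summable, ?_⟩
  simpa only [(hasSum_norm_inner_sq f _).tsum_eq] using hu

/-- The Hilbert-Schmidt inner product can be computed with the adjoints. -/
theorem hasSum_inner_adjoint [CompleteSpace E] [CompleteSpace F] {ι κ : Type*}
    (e : HilbertBasis ι ℂ E) (f : HilbertBasis κ ℂ F)
    (A B : E →L[ℂ] F) (hA : Summable fun i => ‖A (e i)‖ ^ 2)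
    (hB : Summable fun i => ‖B (e i)‖ ^ 2) :
    HasSum (fun i => ⟪A (e i), B (e i)⟫_ℂ)
      (∑' j, ⟪ContinuousLinearMap.adjoint B (f j), ContinuousLinearMap.adjoint A (f j)⟫_ℂ) := by
  -- Absolute summability of the double series, which allows summing it in either order: over `j` it
  -- gives one side, over `i` the other.
  have hGs : Summable fun p : ι × κ => ⟪A (e p.1), f p.2⟫_ℂ * ⟪f p.2, B (e p.1)⟫_ℂ := by
    refine Summable.of_norm ?_
    refine (summable_inner_of_sq (summable_norm_inner_sq f hA)
      (summable_norm_inner_sq f hB)).congr fun p => ?_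
    rw [norm_mul, ← inner_conj_symm (A _), RCLike.norm_conj]
  have h1 : ∀ i, HasSum (fun j => ⟪A (e i), f j⟫_ℂ * ⟪f j, B (e i)⟫_ℂ) ⟪A (e i), B (e i)⟫_ℂ :=
    fun i => f.hasSum_inner_mul_inner _ _
  have h2 : ∀ j, HasSum (fun i => ⟪A (e i), f j⟫_ℂ * ⟪f j, B (e i)⟫_ℂ)
      ⟪ContinuousLinearMap.adjoint B (f j), ContinuousLinearMap.adjoint A (f j)⟫_ℂ := fun j => by
    have := e.hasSum_inner_mul_inner (ContinuousLinearMap.adjoint B (f j))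
      (ContinuousLinearMap.adjoint A (f j))
    refine this.congr_fun fun i => ?_
    rw [ContinuousLinearMap.adjoint_inner_left, ContinuousLinearMap.adjoint_inner_right, mul_comm]
  have h3 := hGs.hasSum.prod_fiberwise h1
  have h4 := ((Equiv.prodComm κ ι).hasSum_iff.2 hGs.hasSum).prod_fiberwise h2
  rw [h4.tsum_eq]
  exact h3

end HilbertSchmidt

/-! ### Traces, finite rank projections and normal functionals -/

section TraceClass

variable {E : Type*} [NormedAddCommGroup E] [InnerProductSpace ℂ E] [CompleteSpace E]

theorem hasSum_trace_rankOne (γ : E →L[ℂ] E) (x y : E) :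
    HasSum (fun i => ⟪hbasis E i, (γ ∘L InnerProductSpace.rankOne ℂ x y) (hbasis E i)⟫_ℂ)
      ⟪y, γ x⟫_ℂ := by
  refine ((hbasis E).hasSum_inner_mul_inner y (γ x)).congr_fun fun i => ?_
  simp

theorem trace_rankOne (γ : E →L[ℂ] E) (x y : E) :
    trace (γ ∘L InnerProductSpace.rankOne ℂ x y) = ⟪y, γ x⟫_ℂ :=
  (hasSum_trace_rankOne γ x y).tsum_eq

/-- Rank-one `b` suffice. Their trace series is a Parseval expansion, so neither operator has to be
trace class. -/
theorem eq_of_trace_comp_eq {γ γ' : E →L[ℂ] E}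
    (h : ∀ b : E →L[ℂ] E, trace (γ ∘L b) = trace (γ' ∘L b)) : γ = γ' := by
  ext x
  refine ext_inner_left ℂ fun y => ?_
  rw [← trace_rankOne, ← trace_rankOne, h]

omit [CompleteSpace E] in
theorem re_inner_nonneg_of_isPositive {γ : E →L[ℂ] E} (hγ : γ.IsPositive) (x : E) :
    0 ≤ (⟪x, γ x⟫_ℂ).re :=
  hγ.re_inner_nonneg_right x

theorem traceNorm_of_isPositive {γ : E →L[ℂ] E} (hγ : γ.IsPositive) :
    traceNorm γ = ∑' i, ENNReal.ofReal (⟪hbasis E i, γ (hbasis E i)⟫_ℂ).re := by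
  rw [traceNorm, CFC.abs_of_nonneg γ ((ContinuousLinearMap.nonneg_iff_isPositive γ).2 hγ)]

/-- The projection on the span of finitely many vectors of the chosen basis. -/
def finProj (E : Type*) [NormedAddCommGroup E] [InnerProductSpace ℂ E] [CompleteSpace E]
    (s : Finset (BasisIndex E)) : E →L[ℂ] E :=
  ∑ i ∈ s, InnerProductSpace.rankOne ℂ (hbasis E i) (hbasis E i)

theorem finProj_apply (s : Finset (BasisIndex E)) (x : E) :
    finProj E s x = ∑ i ∈ s, ⟪hbasis E i, x⟫_ℂ • hbasis E i := by
  simp [finProj]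

theorem tendsto_finProj (x : E) : Tendsto (fun s => finProj E s x) atTop (𝓝 x) := by
  have h := (hbasis E).hasSum_repr x
  simp only [HilbertBasis.repr_apply_apply] at h
  simpa only [finProj_apply, HasSum, SummationFilter.unconditional_filter] using h

theorem isSelfAdjoint_finProj (s : Finset (BasisIndex E)) :
    IsSelfAdjoint (finProj E s) := by
  refine isSelfAdjoint_sum s fun i _ => ?_
  exact (InnerProductSpace.isPositive_rankOne_self (hbasis E i)).isSelfAdjoint

open Classical in
theorem inner_hbasis (i j : BasisIndex E) :
    ⟪hbasis E i, hbasis E j⟫_ℂ = if i = j then 1 else 0 :=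
  orthonormal_iff_ite.1 (hbasis E).orthonormal i j

open Classical in
theorem finProj_hbasis (s : Finset (BasisIndex E)) (j : BasisIndex E) :
    finProj E s (hbasis E j) = if j ∈ s then hbasis E j else 0 := by
  simp [finProj_apply, inner_hbasis]

theorem finProj_mul_self (s : Finset (BasisIndex E)) : finProj E s * finProj E s = finProj E s := by
  classical
  ext x
  rw [mul_apply_eq_comp, finProj_apply s x, map_sum]
  refine Finset.sum_congr rfl fun i hi => ?_
  rw [map_smul, finProj_hbasis, if_pos hi]

theorem norm_finProj_le (s : Finset (BasisIndex E)) : ‖finProj E s‖ ≤ 1 :=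
  IsStarProjection.norm_le _ ⟨finProj_mul_self s, isSelfAdjoint_finProj s⟩

theorem summable_inner_of_isTraceClass {γ : E →L[ℂ] E} (hγ : γ.IsPositive) (h : IsTraceClass γ) :
    Summable fun i => (⟪hbasis E i, γ (hbasis E i)⟫_ℂ).re := by
  rw [IsTraceClass, traceNorm_of_isPositive hγ] at h
  refine (ENNReal.summable_toReal h.ne).congr fun i => ?_
  rw [ENNReal.toReal_ofReal (re_inner_nonneg_of_isPositive hγ _)]

theorem isTraceClass_of_summable {γ : E →L[ℂ] E} (hγ : γ.IsPositive)
    (h : Summable fun i => (⟪hbasis E i, γ (hbasis E i)⟫_ℂ).re) : IsTraceClass γ := by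
  rw [IsTraceClass, traceNorm_of_isPositive hγ,
    ← ENNReal.ofReal_tsum_of_nonneg (fun i => re_inner_nonneg_of_isPositive hγ _) h]
  exact ENNReal.ofReal_lt_top

open scoped ComplexOrder in
/-- A normal positive functional is given by a positive trace class operator. -/
theorem exists_density (φ : (E →L[ℂ] E) →L[ℂ] ℂ)
    (hpos : ∀ x : E, 0 ≤ φ (InnerProductSpace.rankOne ℂ x x))
    (hnorm : ∀ b : E →L[ℂ] E, Tendsto (fun s => φ (b ∘L finProj E s)) atTop (𝓝 (φ b))) :
    ∃ γ : E →L[ℂ] E, γ.IsPositive ∧ IsTraceClass γ ∧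
      ∀ b, HasSum (fun i => ⟪hbasis E i, (γ ∘L b) (hbasis E i)⟫_ℂ) (φ b) := by
  -- The values of `φ` on rank-one operators form a bounded sesquilinear form, and Riesz
  -- representation yields the candidate `γ`.
  let B : E →L⋆[ℂ] E →L[ℂ] ℂ := LinearMap.mkContinuous₂
    (LinearMap.mk₂'ₛₗ (starRingEnd ℂ) (RingHom.id ℂ)
      (fun v w => φ (InnerProductSpace.rankOne ℂ w v)) (by simp) (by simp) (by simp) (by simp))
    ‖φ‖ fun v w => by
      refine (φ.le_opNorm _).trans_eq ?_
      rw [InnerProductSpace.norm_rankOne]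
      ring
  have hB : ∀ v w, B v w = φ (InnerProductSpace.rankOne ℂ w v) := fun v w => rfl
  set γ := ContinuousLinearMap.adjoint (InnerProductSpace.continuousLinearMapOfBilin B) with hγ
  have hin : ∀ x y, ⟪y, γ x⟫_ℂ = φ (InnerProductSpace.rankOne ℂ x y) := fun x y => by
    rw [hγ, ContinuousLinearMap.adjoint_inner_right,
      InnerProductSpace.continuousLinearMapOfBilin_apply, hB]
  have hγpos : γ.IsPositive := by
    rw [ContinuousLinearMap.isPositive_iff']
    refine ⟨?_, fun x => ?_⟩
    · rw [ContinuousLinearMap.isSelfAdjoint_iff_isSymmetric]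
      refine (LinearMap.isSymmetric_iff_inner_map_self_real _).2 fun x => ?_
      have h1 : ⟪x, γ x⟫_ℂ = conj ⟪x, γ x⟫_ℂ := by
        have := hpos x
        rw [hin]
        rw [Complex.le_def] at this
        apply Complex.ext <;> simp [← this.2]
      change conj ⟪γ x, x⟫_ℂ = ⟪γ x, x⟫_ℂ
      rw [inner_conj_symm, h1, inner_conj_symm]
    · rw [← inner_conj_symm, hin]
      have := hpos x
      rw [Complex.le_def] at this ⊢
      simpa [eq_comm] using this
  have hsum : ∀ b : E →L[ℂ] E,
      HasSum (fun i => ⟪hbasis E i, (γ ∘L b) (hbasis E i)⟫_ℂ) (φ b) := fun b => by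
    -- Since `b ∘ finProj s` is a sum of rank-one operators, `φ` of it is exactly the partial trace
    -- over `s`. Normality of `φ` is thus convergence of the trace series.
    refine (hnorm b).congr fun s => ?_
    rw [finProj, ContinuousLinearMap.comp_finsetSum, map_sum]
    refine Finset.sum_congr rfl fun i _ => ?_
    change _ = ⟪hbasis E i, γ (b (hbasis E i))⟫_ℂ
    rw [hin, InnerProductSpace.comp_rankOne]
  refine ⟨γ, hγpos, isTraceClass_of_summable hγpos ?_, hsum⟩
  exact ((hsum (ContinuousLinearMap.id ℂ E)).mapL Complex.reCLM).summable

end TraceClass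

/-! ### Trace norm by duality -/

section TraceNorm

variable {E : Type*} [NormedAddCommGroup E] [InnerProductSpace ℂ E] [CompleteSpace E]

/-- Duality bound for the trace norm of a selfadjoint operator. -/
theorem traceNorm_le_of_trace_comp_le {T : E →L[ℂ] E} (hT : IsSelfAdjoint T) {C : ℝ}
    (hs : ∀ b : E →L[ℂ] E, Summable fun i => ⟪hbasis E i, (T ∘L b) (hbasis E i)⟫_ℂ)
    (hC : ∀ b : E →L[ℂ] E, ‖b‖ ≤ 1 → ‖trace (T ∘L b)‖ ≤ C) :
    traceNorm T ≤ ENNReal.ofReal C := by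
  rw [traceNorm, ENNReal.tsum_eq_iSup_sum]
  refine iSup_le fun s => ?_
  have hpos : ∀ x, 0 ≤ (⟪x, CFC.abs T x⟫_ℂ).re := fun x =>
    re_inner_nonneg_of_isPositive
      ((ContinuousLinearMap.nonneg_iff_isPositive _).1 (CFC.abs_nonneg T)) x
  rw [← ENNReal.ofReal_sum_of_nonneg fun i _ => hpos _]
  refine ENNReal.ofReal_le_ofReal (le_of_forall_pos_le_add fun η hη => ?_)
  -- Each basis vector in `s` will cost an error `δ`; the `+ 1` covers empty `s`.
  set δ : ℝ := η / (s.card + 1) with hδ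
  have hδ0 : 0 < δ := by positivity
  have hden : ∀ t : ℝ, |t| + δ ≠ 0 := fun t => by positivity
  have hf : Continuous fun t : ℝ => t / (|t| + δ) := by fun_prop (disch := exact hden _)
  -- A contraction replacing the sign of `T`, which is in general out of reach of the continuous
  -- functional calculus.
  set b : E →L[ℂ] E := cfc (fun t : ℝ => t / (|t| + δ)) T with hb
  have hb1 : ‖b‖ ≤ 1 := by
    refine norm_cfc_le zero_le_one fun t _ => ?_
    rw [Real.norm_eq_abs, abs_div, abs_of_pos (by positivity : 0 < |t| + δ),
      div_le_one (by positivity)]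
    linarith
  have hTb : T * b = cfc (fun t : ℝ => t * (t / (|t| + δ))) T := by
    rw [hb]
    nth_rw 1 [← cfc_id ℝ T]
    rw [← cfc_mul _ _ T (by fun_prop) hf.continuousOn]
    rfl
  have hTbpos : 0 ≤ T * b := by
    rw [hTb]
    refine cfc_nonneg fun t _ => ?_
    have : t * (t / (|t| + δ)) = t ^ 2 / (|t| + δ) := by ring
    rw [this]
    positivity
  -- On the spectrum the gap is `t² / (|t| + δ) + δ - |t| = δ² / (|t| + δ) ≥ 0`.
  have hle : CFC.abs T ≤ T * b + algebraMap ℝ (E →L[ℂ] E) δ := by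
    have e : T * b + algebraMap ℝ (E →L[ℂ] E) δ
        = cfc (fun t : ℝ => t * (t / (|t| + δ)) + δ) T := by
      rw [cfc_add_const _ _ _ (by fun_prop), hTb]
    rw [e, CFC.abs_eq_cfc_norm T hT]
    refine cfc_mono (fun t _ => ?_) (by fun_prop) (by fun_prop)
    rw [Real.norm_eq_abs, ← sub_nonneg]
    have : t * (t / (|t| + δ)) + δ - |t| = δ ^ 2 / (|t| + δ) := by
      have := hden t
      field_simp
      nlinarith [sq_abs t]
    rw [this]
    positivity
  have hle' : ∀ i, (⟪hbasis E i, CFC.abs T (hbasis E i)⟫_ℂ).re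
      ≤ (⟪hbasis E i, (T ∘L b) (hbasis E i)⟫_ℂ).re + δ := fun i => by
    have h1 := re_inner_nonneg_of_isPositive
      ((ContinuousLinearMap.nonneg_iff_isPositive _).1 (sub_nonneg.2 hle)) (hbasis E i)
    have h2 : ⟪hbasis E i, algebraMap ℝ (E →L[ℂ] E) δ (hbasis E i)⟫_ℂ = δ := by
      rw [Algebra.algebraMap_eq_smul_one]
      change ⟪hbasis E i, (δ : ℝ) • hbasis E i⟫_ℂ = δ
      rw [inner_smul_right_eq_smul, inner_self_eq_norm_sq_to_K, (hbasis E).orthonormal.1 i]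
      simp
    have h3 : (T * b + algebraMap ℝ (E →L[ℂ] E) δ - CFC.abs T) (hbasis E i)
      = (T ∘L b) (hbasis E i) + algebraMap ℝ (E →L[ℂ] E) δ (hbasis E i)
        - CFC.abs T (hbasis E i) := rfl
    rw [h3, inner_sub_right, inner_add_right, h2] at h1
    simp only [Complex.sub_re, Complex.add_re, Complex.ofReal_re] at h1
    linarith
  have hsum := ((hs b).hasSum.mapL Complex.reCLM)
  -- `T b` is positive, so its partial traces are bounded by the full trace.
  have hnn : ∀ i, 0 ≤ (⟪hbasis E i, (T ∘L b) (hbasis E i)⟫_ℂ).re := fun i =>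
    re_inner_nonneg_of_isPositive ((ContinuousLinearMap.nonneg_iff_isPositive _).1 hTbpos) _
  calc ∑ i ∈ s, (⟪hbasis E i, CFC.abs T (hbasis E i)⟫_ℂ).re
      ≤ ∑ i ∈ s, ((⟪hbasis E i, (T ∘L b) (hbasis E i)⟫_ℂ).re + δ) :=
        Finset.sum_le_sum fun i _ => hle' i
    _ = ∑ i ∈ s, (⟪hbasis E i, (T ∘L b) (hbasis E i)⟫_ℂ).re + s.card * δ := by
        rw [Finset.sum_add_distrib, Finset.sum_const, nsmul_eq_mul]
    _ ≤ C + η := by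
        refine add_le_add ?_ ?_
        · refine (sum_le_hasSum s (fun i _ => hnn i) hsum).trans ?_
          exact (Complex.re_le_norm _).trans (hC b hb1)
        · rw [hδ, mul_div_assoc', div_le_iff₀ (by positivity)]
          nlinarith

end TraceNorm

/-! ### Square roots and compression to finite blocks -/

section Sqrt

variable {E : Type*} [NormedAddCommGroup E] [InnerProductSpace ℂ E] [CompleteSpace E]

theorem adjoint_sqrt (γ : E →L[ℂ] E) :
    ContinuousLinearMap.adjoint (CFC.sqrt γ) = CFC.sqrt γ :=
  (CFC.sqrt_nonneg γ).isSelfAdjoint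

theorem inner_sqrt_sqrt {γ : E →L[ℂ] E} (hγ : γ.IsPositive) (x y : E) :
    ⟪CFC.sqrt γ x, CFC.sqrt γ y⟫_ℂ = ⟪x, γ y⟫_ℂ := by
  have h := CFC.sqrt_mul_sqrt_self γ ((ContinuousLinearMap.nonneg_iff_isPositive γ).2 hγ)
  conv_rhs => rw [← h]
  rw [mul_apply_eq_comp, ← ContinuousLinearMap.adjoint_inner_left _ (CFC.sqrt γ y) x, adjoint_sqrt]

theorem norm_sqrt_sq {γ : E →L[ℂ] E} (hγ : γ.IsPositive) (x : E) :
    ‖CFC.sqrt γ x‖ ^ 2 = (⟪x, γ x⟫_ℂ).re := by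
  rw [← inner_sqrt_sqrt hγ, inner_self_eq_norm_sq_to_K]
  norm_cast

/-- The ideal property of Hilbert-Schmidt operators. Right multiplication by `b` becomes left
multiplication by `b*` on the adjoint side, where the bound is termwise. -/
theorem summable_norm_sq_comp {F : Type*} [NormedAddCommGroup F] [InnerProductSpace ℂ F]
    [CompleteSpace F] {ι κ : Type*} (e : HilbertBasis ι ℂ E) (f : HilbertBasis κ ℂ F)
    {A : E →L[ℂ] F} (hA : Summable fun i => ‖A (e i)‖ ^ 2) (b : E →L[ℂ] E) :
    Summable fun i => ‖A (b (e i))‖ ^ 2 := by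
  have h1 : Summable fun j => ‖ContinuousLinearMap.adjoint (A ∘L b) (f j)‖ ^ 2 := by
    refine Summable.of_nonneg_of_le (fun _ => by positivity) (fun j => ?_)
      ((hasSum_norm_sq_adjoint e f A hA.hasSum).summable.mul_left (‖b‖ ^ 2))
    rw [ContinuousLinearMap.adjoint_comp, ← mul_pow]
    refine pow_le_pow_left₀ (norm_nonneg _) ?_ 2
    refine ((ContinuousLinearMap.adjoint b).le_opNorm _).trans_eq ?_
    rw [LinearIsometryEquiv.norm_map]
    rfl
  have h2 := (hasSum_norm_sq_adjoint f e _ h1.hasSum).summable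
  rw [ContinuousLinearMap.adjoint_adjoint] at h2
  exact h2

variable {γ : E →L[ℂ] E}

theorem summable_norm_sqrt_sq (hγ : γ.IsPositive) (h : IsTraceClass γ) :
    Summable fun i => ‖CFC.sqrt γ (hbasis E i)‖ ^ 2 := by
  simpa only [norm_sqrt_sq hγ] using summable_inner_of_isTraceClass hγ h

/-- Cyclicity, `Tr[√γ √γ b] = Tr[√γ b √γ]`, valid because `√γ` and `√γ b` are Hilbert-Schmidt. The
trace becomes a sum of quadratic forms of `b` at the vectors `√γ eⱼ`, whose squared norms sum to `Tr
γ`. -/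
theorem hasSum_trace_comp (hγ : γ.IsPositive) (h : IsTraceClass γ) (b : E →L[ℂ] E) :
    HasSum (fun i => ⟪hbasis E i, (γ ∘L b) (hbasis E i)⟫_ℂ)
      (∑' j, ⟪CFC.sqrt γ (hbasis E j), b (CFC.sqrt γ (hbasis E j))⟫_ℂ) := by
  have h0 := summable_norm_sqrt_sq hγ h
  have h1 := hasSum_inner_adjoint (hbasis E) (hbasis E) (CFC.sqrt γ) (CFC.sqrt γ ∘L b) h0
    (summable_norm_sq_comp (hbasis E) (hbasis E) h0 b)
  simp only [ContinuousLinearMap.adjoint_comp, adjoint_sqrt, ContinuousLinearMap.comp_apply,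
    ContinuousLinearMap.adjoint_inner_left, inner_sqrt_sqrt hγ] at h1
  exact h1

theorem trace_comp (hγ : γ.IsPositive) (h : IsTraceClass γ) (b : E →L[ℂ] E) :
    trace (γ ∘L b) = ∑' j, ⟪CFC.sqrt γ (hbasis E j), b (CFC.sqrt γ (hbasis E j))⟫_ℂ :=
  (hasSum_trace_comp hγ h b).tsum_eq

theorem summable_inner_sqrt (hγ : γ.IsPositive) (h : IsTraceClass γ) (b : E →L[ℂ] E) :
    Summable fun j => ⟪CFC.sqrt γ (hbasis E j), b (CFC.sqrt γ (hbasis E j))⟫_ℂ := by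
  refine Summable.of_norm_bounded ((summable_norm_sqrt_sq hγ h).mul_left ‖b‖) fun j => ?_
  refine (norm_inner_le_norm _ _).trans ?_
  refine (mul_le_mul_of_nonneg_left (b.le_opNorm _) (norm_nonneg _)).trans_eq ?_
  ring

theorem hasSum_re_inner (hγ : γ.IsPositive) (h : IsTraceClass γ) :
    HasSum (fun i => (⟪hbasis E i, γ (hbasis E i)⟫_ℂ).re) (trace γ).re := by
  have h1 := hasSum_trace_comp hγ h (ContinuousLinearMap.id ℂ E)
  rw [← trace_comp hγ h] at h1
  exact h1.mapL Complex.reCLM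

/-- The difference splits into two terms, each containing one factor `(1 - P) v`. Young's inequality
with weight `δ` then leaves only squared norms, which can be summed over `v = √γ eⱼ`. -/
theorem norm_inner_sub_compress_le (b P : E →L[ℂ] E) (hP : IsSelfAdjoint P) (hP1 : ‖P‖ ≤ 1)
    {δ : ℝ} (hδ : 0 < δ) (v : E) :
    ‖⟪v, b v⟫_ℂ - ⟪v, (P ∘L b ∘L P) v⟫_ℂ‖
      ≤ ‖b‖ * (δ * ‖v‖ ^ 2 + ‖(1 - P) v‖ ^ 2 / δ) := by
  have e1 : ⟪v, (P ∘L b ∘L P) v⟫_ℂ = ⟪P v, b (P v)⟫_ℂ := by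
    rw [ContinuousLinearMap.comp_apply, ContinuousLinearMap.comp_apply,
      ← ContinuousLinearMap.adjoint_inner_left]
    rw [show ContinuousLinearMap.adjoint P = P from hP]
  have e2 : ⟪v, b v⟫_ℂ - ⟪P v, b (P v)⟫_ℂ = ⟪(1 - P) v, b v⟫_ℂ + ⟪P v, b ((1 - P) v)⟫_ℂ := by
    change _ = ⟪v - P v, b v⟫_ℂ + ⟪P v, b (v - P v)⟫_ℂ
    rw [map_sub, inner_sub_left, inner_sub_right]
    ring
  have hPv : ‖P v‖ ≤ ‖v‖ := (P.le_opNorm v).trans (by nlinarith [norm_nonneg v])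
  set w := (1 - P) v
  have h1 : ‖⟪w, b v⟫_ℂ‖ ≤ ‖b‖ * (‖v‖ * ‖w‖) := by
    refine (norm_inner_le_norm _ _).trans ?_
    refine (mul_le_mul_of_nonneg_left (b.le_opNorm _) (norm_nonneg _)).trans_eq ?_
    ring
  have h2 : ‖⟪P v, b w⟫_ℂ‖ ≤ ‖b‖ * (‖v‖ * ‖w‖) := by
    refine (norm_inner_le_norm _ _).trans ?_
    refine (mul_le_mul hPv (b.le_opNorm _) (norm_nonneg _) (norm_nonneg _)).trans_eq ?_
    ring
  have h3 : 2 * (‖v‖ * ‖w‖) ≤ δ * ‖v‖ ^ 2 + ‖w‖ ^ 2 / δ := by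
    have : δ * ‖v‖ ^ 2 + ‖w‖ ^ 2 / δ - 2 * (‖v‖ * ‖w‖) = (δ * ‖v‖ - ‖w‖) ^ 2 / δ := by
      field_simp
      ring
    have h4 : 0 ≤ (δ * ‖v‖ - ‖w‖) ^ 2 / δ := by positivity
    linarith
  rw [e1, e2]
  refine (norm_add_le _ _).trans ?_
  nlinarith [mul_le_mul_of_nonneg_left h3 (norm_nonneg b)]

/-- Passing to the adjoint gives `√γ (1 - P) eᵢ`, which is zero for `i ∈ s` and `√γ eᵢ` otherwise.
What remains is the part of the trace outside `s`. -/
theorem hasSum_norm_sub_finProj_sq (hγ : γ.IsPositive) (h : IsTraceClass γ)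
    (s : Finset (BasisIndex E)) :
    HasSum (fun j => ‖(1 - finProj E s) (CFC.sqrt γ (hbasis E j))‖ ^ 2)
      ((trace γ).re - ∑ i ∈ s, (⟪hbasis E i, γ (hbasis E i)⟫_ℂ).re) := by
  classical
  have h1 := hasSum_re_inner hγ h
  have h2 : HasSum (fun i => ‖(CFC.sqrt γ ∘L (1 - finProj E s)) (hbasis E i)‖ ^ 2)
      ((trace γ).re - ∑ i ∈ s, (⟪hbasis E i, γ (hbasis E i)⟫_ℂ).re) := by
    have h3 := h1.sub (hasSum_sum_of_ne_finset_zero (s := s)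
      (f := fun i => if i ∈ s then (⟪hbasis E i, γ (hbasis E i)⟫_ℂ).re else 0)
      fun i hi => if_neg hi)
    rw [Finset.sum_congr rfl fun i hi => if_pos hi] at h3
    refine h3.congr_fun fun i => ?_
    change ‖CFC.sqrt γ (hbasis E i - finProj E s (hbasis E i))‖ ^ 2 = _
    rw [finProj_hbasis]
    split_ifs with hi
    · simp
    · rw [sub_zero, sub_zero, norm_sqrt_sq hγ]
  have h4 := hasSum_norm_sq_adjoint (hbasis E) (hbasis E) _ h2
  rw [ContinuousLinearMap.adjoint_comp, adjoint_sqrt] at h4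
  have h5 : ContinuousLinearMap.adjoint (1 - finProj E s) = 1 - finProj E s :=
    (IsSelfAdjoint.one _).sub (isSelfAdjoint_finProj s)
  rw [h5] at h4
  exact h4

theorem norm_trace_comp_sub_compress_le (hγ : γ.IsPositive) (h : IsTraceClass γ)
    (s : Finset (BasisIndex E)) (b : E →L[ℂ] E) {δ : ℝ} (hδ : 0 < δ) :
    ‖trace (γ ∘L b) - trace (γ ∘L (finProj E s ∘L b ∘L finProj E s))‖
      ≤ ‖b‖ * (δ * (trace γ).re
        + ((trace γ).re - ∑ i ∈ s, (⟪hbasis E i, γ (hbasis E i)⟫_ℂ).re) / δ) := by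
  rw [trace_comp hγ h, trace_comp hγ h,
    ← (summable_inner_sqrt hγ h b).tsum_sub (summable_inner_sqrt hγ h _)]
  have h1 := hasSum_re_inner hγ h
  simp only [← norm_sqrt_sq hγ] at h1
  have h2 := ((h1.mul_left δ).add ((hasSum_norm_sub_finProj_sq hγ h s).div_const δ)).mul_left ‖b‖
  simp only [← norm_sqrt_sq hγ] at h2 ⊢
  exact tsum_of_norm_bounded h2 fun j =>
    norm_inner_sub_compress_le b _ (isSelfAdjoint_finProj s) (norm_finProj_le s) hδ _

/-- After compression only finitely many matrix elements of `γ` matter, which is where weak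
convergence will suffice. -/
theorem trace_comp_compress (γ : E →L[ℂ] E) (s : Finset (BasisIndex E)) (b : E →L[ℂ] E) :
    trace (γ ∘L (finProj E s ∘L b ∘L finProj E s))
      = ∑ j ∈ s, ∑ i ∈ s, ⟪hbasis E i, b (hbasis E j)⟫_ℂ * ⟪hbasis E j, γ (hbasis E i)⟫_ℂ := by
  classical
  rw [trace, tsum_eq_sum (s := s)]
  · refine Finset.sum_congr rfl fun j hj => ?_
    simp only [ContinuousLinearMap.comp_apply]
    rw [finProj_hbasis, if_pos hj, finProj_apply, map_sum, inner_sum]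
    simp [inner_smul_right]
  · intro j hj
    simp only [ContinuousLinearMap.comp_apply]
    rw [finProj_hbasis, if_neg hj]
    simp

end Sqrt

/-! ### From weak convergence to trace norm convergence -/

section Convergence

variable {E : Type*} [NormedAddCommGroup E] [InnerProductSpace ℂ E] [CompleteSpace E]

/-- Test against a contraction `b` and replace it by its compression in both traces: each
replacement costs a tail of the trace, and the compressed traces differ by finitely many matrix
elements. -/
theorem traceNorm_sub_le {γ γ' : E →L[ℂ] E} (hγ : γ.IsPositive) (h : IsTraceClass γ)
    (hγ' : γ'.IsPositive) (h' : IsTraceClass γ') (s : Finset (BasisIndex E)) {δ : ℝ}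
    (hδ : 0 < δ) :
    traceNorm (γ - γ') ≤ ENNReal.ofReal
      ((δ * (trace γ).re
        + ((trace γ).re - ∑ i ∈ s, (⟪hbasis E i, γ (hbasis E i)⟫_ℂ).re) / δ)
      + (δ * (trace γ').re
        + ((trace γ').re - ∑ i ∈ s, (⟪hbasis E i, γ' (hbasis E i)⟫_ℂ).re) / δ)
      + ∑ j ∈ s, ∑ i ∈ s, ‖⟪hbasis E j, γ (hbasis E i)⟫_ℂ - ⟪hbasis E j, γ' (hbasis E i)⟫_ℂ‖) := by
  have hsub : ∀ b : E →L[ℂ] E, HasSum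
      (fun i => ⟪hbasis E i, ((γ - γ') ∘L b) (hbasis E i)⟫_ℂ)
      (trace (γ ∘L b) - trace (γ' ∘L b)) := fun b => by
    rw [trace_comp hγ h, trace_comp hγ' h']
    refine ((hasSum_trace_comp hγ h b).sub (hasSum_trace_comp hγ' h' b)).congr_fun fun i => ?_
    rw [← inner_sub_right]
    rfl
  refine traceNorm_le_of_trace_comp_le (hγ.isSelfAdjoint.sub hγ'.isSelfAdjoint)
    (fun b => (hsub b).summable) fun b hb => ?_
  rw [trace, (hsub b).tsum_eq]
  set P := finProj E s
  have e : trace (γ ∘L b) - trace (γ' ∘L b)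
      = (trace (γ ∘L b) - trace (γ ∘L (P ∘L b ∘L P)))
        - (trace (γ' ∘L b) - trace (γ' ∘L (P ∘L b ∘L P)))
        + (trace (γ ∘L (P ∘L b ∘L P)) - trace (γ' ∘L (P ∘L b ∘L P))) := by ring
  have h1 := norm_trace_comp_sub_compress_le hγ h s b hδ
  have h2 := norm_trace_comp_sub_compress_le hγ' h' s b hδ
  have h3 : ‖trace (γ ∘L (P ∘L b ∘L P)) - trace (γ' ∘L (P ∘L b ∘L P))‖ ≤ ∑ j ∈ s, ∑ i ∈ s,
      ‖⟪hbasis E j, γ (hbasis E i)⟫_ℂ - ⟪hbasis E j, γ' (hbasis E i)⟫_ℂ‖ := by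
    rw [trace_comp_compress, trace_comp_compress, ← Finset.sum_sub_distrib]
    refine norm_sum_le_of_le _ fun j _ => ?_
    rw [← Finset.sum_sub_distrib]
    refine norm_sum_le_of_le _ fun i _ => ?_
    rw [← mul_sub, norm_mul]
    refine mul_le_of_le_one_left (norm_nonneg _) ?_
    refine (norm_inner_le_norm _ _).trans ?_
    rw [(hbasis E).orthonormal.1 i, one_mul]
    refine (b.le_opNorm _).trans ?_
    rw [(hbasis E).orthonormal.1 j, mul_one]
    exact hb
  have key : ∀ {γ : E →L[ℂ] E}, γ.IsPositive → IsTraceClass γ → 0 ≤ δ * (trace γ).re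
        + ((trace γ).re - ∑ i ∈ s, (⟪hbasis E i, γ (hbasis E i)⟫_ℂ).re) / δ := fun hγ h => by
    have := (hasSum_re_inner hγ h).nonneg fun i => re_inner_nonneg_of_isPositive hγ _
    have := (hasSum_norm_sub_finProj_sq hγ h s).nonneg fun i => by positivity
    positivity
  rw [e]
  refine (norm_add_le _ _).trans (add_le_add ((norm_sub_le _ _).trans (add_le_add ?_ ?_)) h3)
  · exact h1.trans (mul_le_of_le_one_left (key hγ h) hb)
  · exact h2.trans (mul_le_of_le_one_left (key hγ' h') hb)

/-- Weak convergence of positive trace class operators together with convergence of the traces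
implies convergence in trace norm. -/
theorem tendsto_traceNorm_sub {α : Type*} {l : Filter α} {γ : α → E →L[ℂ] E} {γ' : E →L[ℂ] E}
    (hγ : ∀ᶠ a in l, (γ a).IsPositive) (h : ∀ᶠ a in l, IsTraceClass (γ a))
    (hγ' : γ'.IsPositive) (h' : IsTraceClass γ')
    (hweak : ∀ x y, Tendsto (fun a => ⟪y, γ a x⟫_ℂ) l (𝓝 ⟪y, γ' x⟫_ℂ))
    (htrace : Tendsto (fun a => trace (γ a)) l (𝓝 (trace γ'))) :
    Tendsto (fun a => traceNorm (γ a - γ')) l (𝓝 0) := by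
  have hre : ∀ {f : α → ℂ} {z : ℂ}, Tendsto f l (𝓝 z) → Tendsto (fun a => (f a).re) l (𝓝 z.re) :=
    fun hf => (Complex.continuous_re.tendsto _).comp hf
  rw [ENNReal.tendsto_nhds_zero]
  intro η₀ hη₀
  obtain ⟨η, hη, hηle⟩ : ∃ η : ℝ, 0 < η ∧ ENNReal.ofReal η ≤ η₀ := by
    obtain ⟨r, hr, hrlt⟩ := ENNReal.lt_iff_exists_nnreal_btwn.1 hη₀
    exact ⟨r, by exact_mod_cast hr, by simpa using hrlt.le⟩
  set t := (trace γ').re with ht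
  have hs := hasSum_re_inner hγ' h'
  have ht0 : 0 ≤ t := hs.nonneg fun i => re_inner_nonneg_of_isPositive hγ' _
  -- With this `δ` and `s` below, `δ t` and the tail divided by `δ` are each at most `η / 8`. The
  -- two operators together cost at most `η / 2` in the limit. The `+ 1` covers `t = 0`.
  set δ : ℝ := η / (8 * (t + 1)) with hδ
  have hδ0 : 0 < δ := by positivity
  have hδt : δ * t ≤ η / 8 := by
    rw [hδ, div_mul_eq_mul_div, div_le_div_iff₀ (by positivity) (by norm_num)]
    nlinarith
  obtain ⟨s, hs'⟩ : ∃ s : Finset (BasisIndex E),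
      t - ∑ i ∈ s, (⟪hbasis E i, γ' (hbasis E i)⟫_ℂ).re < δ * (η / 8) := by
    have h1 : Tendsto (fun s : Finset (BasisIndex E) =>
        ∑ i ∈ s, (⟪hbasis E i, γ' (hbasis E i)⟫_ℂ).re) atTop (𝓝 t) := by
      simpa only [HasSum, SummationFilter.unconditional_filter] using hs
    have h2 := h1.const_sub t
    rw [sub_self] at h2
    exact (h2.eventually_lt_const (by positivity)).exists
  -- The tails of `γ a` outside the fixed `s` converge too, as differences of the full trace and a
  -- finite sum of diagonal elements. This is the tightness.
  have hlim : Tendsto (fun a => (δ * (trace (γ a)).re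
        + ((trace (γ a)).re - ∑ i ∈ s, (⟪hbasis E i, γ a (hbasis E i)⟫_ℂ).re) / δ)
      + (δ * t + (t - ∑ i ∈ s, (⟪hbasis E i, γ' (hbasis E i)⟫_ℂ).re) / δ)
      + ∑ j ∈ s, ∑ i ∈ s,
        ‖⟪hbasis E j, γ a (hbasis E i)⟫_ℂ - ⟪hbasis E j, γ' (hbasis E i)⟫_ℂ‖) l
      (𝓝 ((δ * t + (t - ∑ i ∈ s, (⟪hbasis E i, γ' (hbasis E i)⟫_ℂ).re) / δ)
      + (δ * t + (t - ∑ i ∈ s, (⟪hbasis E i, γ' (hbasis E i)⟫_ℂ).re) / δ)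
      + ∑ j ∈ s, ∑ i ∈ s,
        ‖⟪hbasis E j, γ' (hbasis E i)⟫_ℂ - ⟪hbasis E j, γ' (hbasis E i)⟫_ℂ‖)) := by
    refine Tendsto.add (Tendsto.add (Tendsto.add ?_ ?_) tendsto_const_nhds) ?_
    · exact (hre htrace).const_mul δ
    · exact ((hre htrace).sub (tendsto_finsetSum _ fun i _ => hre (hweak _ _))).div_const δ
    · exact tendsto_finsetSum _ fun j _ => tendsto_finsetSum _ fun i _ =>
        ((hweak _ _).sub_const _).norm
  have hlt := hlim.eventually_lt_const (u := η) (by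
    have : (t - ∑ i ∈ s, (⟪hbasis E i, γ' (hbasis E i)⟫_ℂ).re) / δ < η / 8 := by
      rw [div_lt_iff₀ hδ0]
      linarith
    simp only [sub_self, norm_zero, Finset.sum_const_zero]
    linarith)
  filter_upwards [hγ, h, hlt] with a ha1 ha2 ha3
  exact (traceNorm_sub_le ha1 ha2 hγ' h' s hδ0).trans
    ((ENNReal.ofReal_le_ofReal ha3.le).trans hηle)

end Convergence

/-! ### Separability and continuity of product vectors -/

section Separable

/-- Distinct basis vectors are `√2` apart, so they cannot share an approximant within `1/2`.
Countability makes the filter of finite index sets countably generated, as dominated convergence for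
integrals requires. -/
theorem countable_basisIndex (E : Type*) [NormedAddCommGroup E] [InnerProductSpace ℂ E]
    [CompleteSpace E] [TopologicalSpace.SeparableSpace E] : Countable (BasisIndex E) := by
  have h : ∀ i, ∃ n, dist (hbasis E i) (TopologicalSpace.denseSeq E n) < 1 / 2 := fun i =>
    (TopologicalSpace.denseRange_denseSeq E).exists_dist_lt _ (by norm_num)
  choose n hn using h
  refine Function.Injective.countable (f := n) fun i j hij => ?_
  by_contra hne
  have h1 : dist (hbasis E i) (hbasis E j) < 1 := by
    have h2 := hn j
    rw [← hij, dist_comm] at h2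
    linarith [dist_triangle (hbasis E i) (TopologicalSpace.denseSeq E (n i)) (hbasis E j), hn i]
  have h3 : ‖hbasis E i - hbasis E j‖ ^ 2 = 2 := by
    rw [@norm_sub_sq ℂ, (hbasis E).orthonormal.1, (hbasis E).orthonormal.1,
      (hbasis E).orthonormal.2 hne]
    norm_num
  rw [dist_eq_norm] at h1
  nlinarith [norm_nonneg (hbasis E i - hbasis E j)]

variable {Z : Type*} [NormedAddCommGroup Z] [InnerProductSpace ℂ Z]

/-- The squared distance expands into products of inner products, hence is continuous in `x` and
vanishes at `x = y`. -/
theorem continuous_tmul (n : ℕ) : Continuous (tmul : (Fin n → Z) → TensorPow Z n) := by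
  rw [continuous_iff_continuousAt]
  intro y
  rw [ContinuousAt, tendsto_iff_norm_sub_tendsto_zero]
  have h1 : ∀ x : Fin n → Z, ‖tmul x - tmul y‖ ^ 2 = (∏ i, ⟪x i, x i⟫_ℂ).re
      - 2 * (∏ i, ⟪x i, y i⟫_ℂ).re + (∏ i, ⟪y i, y i⟫_ℂ).re := fun x => by
    rw [@norm_sub_sq ℂ, ← inner_tmul, ← inner_tmul, ← inner_tmul,
      inner_self_eq_norm_sq_to_K, inner_self_eq_norm_sq_to_K]
    norm_cast
  have h2 : Tendsto (fun x : Fin n → Z => ‖tmul x - tmul y‖ ^ 2) (𝓝 y) (𝓝 0) := by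
    simp_rw [h1]
    have hc : Continuous fun x : Fin n → Z => (∏ i, ⟪x i, x i⟫_ℂ).re
      - 2 * (∏ i, ⟪x i, y i⟫_ℂ).re + (∏ i, ⟪y i, y i⟫_ℂ).re := by fun_prop
    have := hc.tendsto y
    convert this using 2
    ring
  have h3 := (Real.continuous_sqrt.tendsto 0).comp h2
  simpa [Function.comp_def, Real.sqrt_sq] using h3

instance separableSpace_tensorPow [TopologicalSpace.SeparableSpace Z] (n : ℕ) :
    TopologicalSpace.SeparableSpace (TensorPow Z n) := by
  rw [← TopologicalSpace.isSeparable_univ_iff]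
  have h1 : TopologicalSpace.IsSeparable (Set.range (tmul : (Fin n → Z) → TensorPow Z n)) :=
    TopologicalSpace.isSeparable_range (continuous_tmul n)
  refine (h1.span (R := ℂ)).closure.mono fun f _ => ?_
  refine closure_mono ?_ (denseRange_tcomb (Z := Z) n f)
  rintro _ ⟨g, rfl⟩
  rw [tcomb, Finsupp.linearCombination_apply]
  exact Submodule.sum_mem _ fun x _ => Submodule.smul_mem _ _ (Submodule.subset_span ⟨x, rfl⟩)

instance separableSpace_symPow [TopologicalSpace.SeparableSpace Z] (n : ℕ) :
    TopologicalSpace.SeparableSpace (SymPow Z n) :=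
  (TopologicalSpace.IsSeparable.of_separableSpace (SymPow Z n : Set (TensorPow Z n))).separableSpace

theorem continuous_tpow (p : ℕ) : Continuous (tpow p : Z → SymPow Z p) :=
  ((continuous_tmul p).comp (by fun_prop : Continuous fun (z : Z) (_ : Fin p) => z)).subtype_mk _

theorem inner_tpow (p : ℕ) (z : Z) : ⟪tpow p z, tpow p z⟫_ℂ = ((‖z‖ ^ (2 * p) : ℝ) : ℂ) := by
  change ⟪tmul fun _ => z, tmul fun _ => z⟫_ℂ = _
  rw [inner_tmul, Finset.prod_const, inner_self_eq_norm_sq_to_K, Finset.card_fin, pow_mul]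
  norm_cast

theorem norm_tpow_sq (p : ℕ) (z : Z) : ‖tpow p z‖ ^ 2 = ‖z‖ ^ (2 * p) := by
  have := inner_tpow p z
  rw [inner_self_eq_norm_sq_to_K] at this
  apply Complex.ofReal_injective
  simpa using this

end Separable

/-! ### Integrals of rank-one operators -/

section Integral

variable {E : Type*} [NormedAddCommGroup E] [InnerProductSpace ℂ E] [CompleteSpace E]
  {X : Type*} [MeasurableSpace X] {μ : Measure X} {v : X → E}

theorem continuous_rankOne_self :
    Continuous fun x : E => InnerProductSpace.rankOne ℂ x x := by
  have h : Continuous fun x : E => (innerSL ℂ x).smulRight x :=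
    ((ContinuousLinearMap.smulRightL ℂ E E).continuous.comp (innerSL ℂ).continuous).clm_apply
      continuous_id
  exact h

theorem integrable_rankOne (hv : AEStronglyMeasurable v μ) (h2 : Integrable (fun z => ‖v z‖ ^ 2) μ) :
    Integrable (fun z => InnerProductSpace.rankOne ℂ (v z) (v z)) μ := by
  refine h2.mono' (continuous_rankOne_self.comp_aestronglyMeasurable hv) (ae_of_all _ fun z => ?_)
  rw [InnerProductSpace.norm_rankOne, sq]

omit [CompleteSpace E] in
theorem norm_inner_apply_le (b : E →L[ℂ] E) (x : E) : ‖⟪x, b x⟫_ℂ‖ ≤ ‖b‖ * ‖x‖ ^ 2 := by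
  refine (norm_inner_le_norm _ _).trans ?_
  refine (mul_le_mul_of_nonneg_left (b.le_opNorm _) (norm_nonneg _)).trans_eq ?_
  ring

omit [CompleteSpace E] in
theorem integrable_inner_apply (hv : AEStronglyMeasurable v μ)
    (h2 : Integrable (fun z => ‖v z‖ ^ 2) μ) (b : E →L[ℂ] E) :
    Integrable (fun z => ⟪v z, b (v z)⟫_ℂ) μ :=
  (h2.const_mul ‖b‖).mono' (hv.inner (b.continuous.comp_aestronglyMeasurable hv))
    (ae_of_all _ fun z => norm_inner_apply_le b (v z))

open scoped ComplexOrder in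
-- The functional `b ↦ ∫ ⟪v, b v⟫` is positive, and normal by dominated convergence with majorant
-- `‖b‖ ‖v‖²`. Its density agrees with the Bochner integral because their matrix elements do.
theorem integral_rankOne [TopologicalSpace.SeparableSpace E] (hv : AEStronglyMeasurable v μ)
    (h2 : Integrable (fun z => ‖v z‖ ^ 2) μ) :
    (∫ z, InnerProductSpace.rankOne ℂ (v z) (v z) ∂μ).IsPositive ∧
    IsTraceClass (∫ z, InnerProductSpace.rankOne ℂ (v z) (v z) ∂μ) ∧
    ∀ b : E →L[ℂ] E, trace ((∫ z, InnerProductSpace.rankOne ℂ (v z) (v z) ∂μ) ∘L b)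
      = ∫ z, ⟪v z, b (v z)⟫_ℂ ∂μ := by
  have := countable_basisIndex E
  have hint := integrable_inner_apply hv h2
  let φ : (E →L[ℂ] E) →L[ℂ] ℂ := LinearMap.mkContinuous
    { toFun := fun b => ∫ z, ⟪v z, b (v z)⟫_ℂ ∂μ
      map_add' := fun b b' => by
        rw [← integral_add (hint b) (hint b')]
        simp
      map_smul' := fun c b => by
        simp [integral_const_mul] }
    (∫ z, ‖v z‖ ^ 2 ∂μ) fun b => by
      refine (norm_integral_le_of_norm_le (h2.const_mul ‖b‖)
        (ae_of_all _ fun z => norm_inner_apply_le b (v z))).trans_eq ?_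
      rw [integral_const_mul, mul_comm]
  have hφ : ∀ b, φ b = ∫ z, ⟪v z, b (v z)⟫_ℂ ∂μ := fun b => rfl
  obtain ⟨γ, h1, h3, h4⟩ := exists_density φ (fun x => by
      have e : ∀ z, ⟪v z, InnerProductSpace.rankOne ℂ x x (v z)⟫_ℂ
          = ((‖⟪x, v z⟫_ℂ‖ ^ 2 : ℝ) : ℂ) := fun z => by
        rw [InnerProductSpace.rankOne_apply, inner_smul_right, ← inner_conj_symm (v z) x,
          Complex.mul_conj']
        norm_cast
      rw [hφ]
      simp_rw [e]
      rw [integral_complex_ofReal]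
      exact Complex.zero_le_real.2 (integral_nonneg fun z => by positivity)) fun b => by
      refine tendsto_integral_filter_of_dominated_convergence (fun z => ‖b‖ * ‖v z‖ ^ 2)
        (Eventually.of_forall fun s => (hint _).aestronglyMeasurable)
        (Eventually.of_forall fun s => ae_of_all _ fun z => ?_) (h2.const_mul _)
        (ae_of_all _ fun z => ?_)
      · refine (norm_inner_apply_le _ _).trans ?_
        refine mul_le_mul_of_nonneg_right ?_ (by positivity)
        refine (ContinuousLinearMap.opNorm_comp_le _ _).trans ?_
        exact mul_le_of_le_one_right (norm_nonneg _) (norm_finProj_le s)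
      · exact tendsto_const_nhds.inner ((b.continuous.tendsto _).comp (tendsto_finProj (v z)))
  have e : ∫ z, InnerProductSpace.rankOne ℂ (v z) (v z) ∂μ = γ := by
    ext x
    refine ext_inner_left ℂ fun y => ?_
    rw [← trace_rankOne γ, trace, (h4 _).tsum_eq, hφ,
      ContinuousLinearMap.integral_apply (integrable_rankOne hv h2), ← integral_inner]
    · refine integral_congr_ae (ae_of_all _ fun z => ?_)
      simp only [InnerProductSpace.rankOne_apply, inner_smul_right]
      ring
    · exact (integrable_rankOne hv h2).apply_continuousLinearMap x
  rw [e]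
  exact ⟨h1, h3, fun b => (h4 b).tsum_eq⟩

theorem trace_smul_comp (c : ℂ) (γ b : E →L[ℂ] E) : trace ((c • γ) ∘L b) = c * trace (γ ∘L b) := by
  rw [trace, trace, ← tsum_mul_left]
  refine tsum_congr fun i => ?_
  simp

open scoped ComplexOrder in
theorem IsTraceClass.smul_of_nonneg {γ : E →L[ℂ] E} (hγ : γ.IsPositive) (h : IsTraceClass γ)
    {c : ℝ} (hc : 0 ≤ c) : IsTraceClass ((c : ℂ) • γ) := by
  refine isTraceClass_of_summable (hγ.smul_of_nonneg (Complex.zero_le_real.2 hc)) ?_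
  refine ((summable_inner_of_isTraceClass hγ h).mul_left c).congr fun i => ?_
  simp

end Integral

/-! ### Positivity, norm and strong continuity of `A ⊗ I` -/

section TensorId

variable {Z : Type*} [NormedAddCommGroup Z] [InnerProductSpace ℂ Z]

theorem ext_tmul {E : Type*} [NormedAddCommGroup E] [InnerProductSpace ℂ E] {n : ℕ}
    {A B : TensorPow Z n →L[ℂ] E} (h : ∀ x, A (tmul x) = B (tmul x)) : A = B := by
  ext f
  induction f using tensor_induction with
  | hc => exact isClosed_eq A.continuous B.continuous
  | h0 => simp
  | hadd f g hf hg => rw [map_add, map_add, hf, hg]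
  | hsmul a x => rw [map_smul, map_smul, h]

theorem insertR_leftPart_rightPart {p m : ℕ} (x : Fin (p + m) → Z) :
    insertR (rightPart rfl x) (tmul (leftPart rfl x)) = tmul x := by
  rw [insertR_tmul]
  congr 1
  exact Fin.append_castAdd_natAdd

theorem tensorId_add {p q m n : ℕ} (h : p + m = n) (A B : TensorPow Z p →L[ℂ] TensorPow Z q) :
    tensorId h (A + B) = tensorId h A + tensorId h B :=
  ext_tmul fun x => by
    simp only [add_apply, tensorId_tmul, map_add]

theorem tensorId_smul {p q m n : ℕ} (h : p + m = n) (c : ℂ)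
    (A : TensorPow Z p →L[ℂ] TensorPow Z q) :
    tensorId h (c • A) = c • tensorId h A :=
  ext_tmul fun x => by
    simp only [smul_apply, tensorId_tmul, map_smul]

theorem tensorId_id {p m : ℕ} :
    tensorId (Z := Z) (rfl : p + m = p + m) (ContinuousLinearMap.id ℂ (TensorPow Z p))
      = ContinuousLinearMap.id ℂ (TensorPow Z (p + m)) :=
  ext_tmul fun x => by
    rw [tensorId_tmul]
    exact insertR_leftPart_rightPart x

/-- This is `(A ⊗ I)* (B ⊗ I) = A* B ⊗ I`, checked on product vectors, where the inner products
factor. -/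
theorem inner_tensorId {p q m : ℕ} (A B : TensorPow Z p →L[ℂ] TensorPow Z q)
    (f g : TensorPow Z (p + m)) :
    ⟪tensorId rfl A f, tensorId rfl B g⟫_ℂ
      = ⟪f, tensorId rfl (ContinuousLinearMap.adjoint A ∘L B) g⟫_ℂ := by
  induction f using tensor_induction with
  | hc => exact isClosed_eq (by fun_prop) (by fun_prop)
  | h0 => simp
  | hadd f f' hf hf' => simp only [map_add, inner_add_left, hf, hf']
  | hsmul a x =>
    induction g using tensor_induction with
    | hc => exact isClosed_eq (by fun_prop) (by fun_prop)
    | h0 => simp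
    | hadd f f' hf hf' => simp only [map_add, inner_add_right, hf, hf']
    | hsmul b x' =>
      have e : ⟪tmul x, insertR (rightPart rfl x')
          ((ContinuousLinearMap.adjoint A ∘L B) (tmul (leftPart rfl x')))⟫_ℂ
          = ⟪insertR (rightPart rfl x) (tmul (leftPart rfl x)), insertR (rightPart rfl x')
          ((ContinuousLinearMap.adjoint A ∘L B) (tmul (leftPart rfl x')))⟫_ℂ := by
        rw [insertR_leftPart_rightPart]
      simp only [map_smul, inner_smul_left, inner_smul_right, tensorId_tmul]
      rw [e, inner_insertR, inner_insertR, ContinuousLinearMap.comp_apply,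
        ContinuousLinearMap.adjoint_inner_right]

theorem inner_tensorId_of_isPositive {p m : ℕ} {B : TensorPow Z p →L[ℂ] TensorPow Z p}
    (hB : B.IsPositive) (f : TensorPow Z (p + m)) :
    ⟪f, tensorId rfl B f⟫_ℂ = ((‖tensorId rfl (CFC.sqrt B) f‖ ^ 2 : ℝ) : ℂ) := by
  have h := CFC.sqrt_mul_sqrt_self B ((ContinuousLinearMap.nonneg_iff_isPositive B).2 hB)
  have h1 := inner_tensorId (m := m) (CFC.sqrt B) (CFC.sqrt B) f f
  rw [adjoint_sqrt, show CFC.sqrt B ∘L CFC.sqrt B = B from h, inner_self_eq_norm_sq_to_K] at h1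
  rw [← h1]
  norm_cast

/-- Tensoring with `I` preserves positivity; apply this to `‖A‖² - A* A ≥ 0`. -/
theorem norm_tensorId_apply_le {p m : ℕ} (A : TensorPow Z p →L[ℂ] TensorPow Z p)
    (f : TensorPow Z (p + m)) : ‖tensorId rfl A f‖ ≤ ‖A‖ * ‖f‖ := by
  set D : TensorPow Z p →L[ℂ] TensorPow Z p :=
    ((‖A‖ ^ 2 : ℝ) : ℂ) • ContinuousLinearMap.id ℂ (TensorPow Z p)
      + (-1 : ℂ) • (ContinuousLinearMap.adjoint A ∘L A) with hD
  have hDpos : D.IsPositive := by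
    rw [← ContinuousLinearMap.nonneg_iff_isPositive]
    have h := sub_nonneg.2 (CStarAlgebra.star_mul_le_algebraMap_norm_sq (a := A))
    have e : D = algebraMap ℝ _ (‖A‖ ^ 2) - star A * A := by
      rw [hD, neg_one_smul, ← sub_eq_add_neg, Algebra.algebraMap_eq_smul_one]
      rfl
    rw [e]
    exact h
  have h1 := inner_tensorId_of_isPositive (m := m) hDpos f
  rw [hD, tensorId_add, tensorId_smul, tensorId_smul, tensorId_id, ← hD,
    add_apply, smul_apply, smul_apply,
    inner_add_right, inner_smul_right, inner_smul_right, ← inner_tensorId,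
    ContinuousLinearMap.id_apply, inner_self_eq_norm_sq_to_K, inner_self_eq_norm_sq_to_K] at h1
  have h2 : ‖A‖ ^ 2 * ‖f‖ ^ 2 - ‖tensorId rfl A f‖ ^ 2
      = ‖tensorId rfl (CFC.sqrt D) f‖ ^ 2 := by
    apply Complex.ofReal_injective
    rw [← h1]
    push_cast
    change _ = _ * (‖f‖ : ℂ) ^ 2 + -1 * (‖tensorId rfl A f‖ : ℂ) ^ 2
    ring
  refine abs_le_of_sq_le_sq' ?_ (by positivity) |>.2
  nlinarith [sq_nonneg ‖tensorId rfl (CFC.sqrt D) f‖]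

/-- On product vectors the convergence is inherited from the `p`-particle factor. The uniform norm
bound gives equicontinuity, so the set of vectors where convergence holds is closed. -/
theorem tendsto_tensorId {α : Type*} {l : Filter α} {p m : ℕ}
    {A : α → TensorPow Z p →L[ℂ] TensorPow Z p} {B : TensorPow Z p →L[ℂ] TensorPow Z p}
    (hA : ∀ f, Tendsto (fun a => A a f) l (𝓝 (B f))) {C : ℝ} (hC : ∀ a, ‖A a‖ ≤ C)
    (f : TensorPow Z (p + m)) :
    Tendsto (fun a => tensorId rfl (A a) f) l (𝓝 (tensorId rfl B f)) := by
  have heq : Equicontinuous fun (a : α) (f : TensorPow Z (p + m)) => tensorId rfl (A a) f := by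
    refine (LipschitzWith.uniformEquicontinuous _ C.toNNReal fun a => ?_).equicontinuous
    refine AddMonoidHomClass.lipschitz_of_bound (tensorId rfl (A a)) C fun f => ?_
    exact (norm_tensorId_apply_le _ _).trans
      (mul_le_mul_of_nonneg_right (hC a) (norm_nonneg _))
  induction f using tensor_induction with
  | hc => exact heq.isClosed_setOfPred_tendsto (ContinuousLinearMap.continuous _)
  | h0 => simpa using tendsto_const_nhds
  | hadd f g hf hg => simpa only [map_add] using hf.add hg
  | hsmul c x =>
    simp only [map_smul, tensorId_tmul]
    exact (((insertR _).continuous.tendsto _).comp (hA _)).const_smul c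

end TensorId

/-! ### The operators `b ∨ I` on symmetric tensors -/

section SymTensorId

variable {Z : Type*} [NormedAddCommGroup Z] [InnerProductSpace ℂ Z]

/-- The extension of an operator on `⋁ᵖ Z` by zero to `⨂ᵖ Z`. -/
def extendSym {p : ℕ} (b : SymPow Z p →L[ℂ] SymPow Z p) : TensorPow Z p →L[ℂ] TensorPow Z p :=
  (SymPow Z p).subtypeL ∘L b ∘L symProj p

theorem norm_symProj_apply_le {n : ℕ} (f : TensorPow Z n) : ‖symProj n f‖ ≤ ‖f‖ :=
  (SymPow Z n).norm_orthogonalProjectionOnto_apply_le f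

theorem norm_extendSym_le {p : ℕ} (b : SymPow Z p →L[ℂ] SymPow Z p) : ‖extendSym b‖ ≤ ‖b‖ := by
  refine ContinuousLinearMap.opNorm_le_bound _ (norm_nonneg b) fun f => ?_
  exact (b.le_opNorm _).trans
    (mul_le_mul_of_nonneg_left (norm_symProj_apply_le f) (norm_nonneg _))

theorem extendSym_isPositive {p : ℕ} {b : SymPow Z p →L[ℂ] SymPow Z p} (hb : b.IsPositive) :
    (extendSym b).IsPositive := by
  have h := hb.conj_adjoint (SymPow Z p).subtypeL
  rw [Submodule.adjoint_subtypeL] at h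
  exact h

theorem symTensorId_apply {p m : ℕ} (b : SymPow Z p →L[ℂ] SymPow Z p) (f : SymPow Z (p + m)) :
    symTensorId rfl b f = symProj (p + m) (tensorId rfl (extendSym b) (f : TensorPow Z (p + m))) :=
  rfl

theorem symTensorId_add {p q m n : ℕ} (h : p + m = n) (b b' : SymPow Z p →L[ℂ] SymPow Z q) :
    symTensorId h (b + b') = symTensorId h b + symTensorId h b' := by
  simp only [symTensorId, ContinuousLinearMap.add_comp, ContinuousLinearMap.comp_add, tensorId_add]

theorem symTensorId_smul {p q m n : ℕ} (h : p + m = n) (c : ℂ)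
    (b : SymPow Z p →L[ℂ] SymPow Z q) :
    symTensorId h (c • b) = c • symTensorId h b := by
  simp only [symTensorId, ContinuousLinearMap.smul_comp, ContinuousLinearMap.comp_smul,
    tensorId_smul]

/-- Against a symmetric vector the outer projection is invisible, so positivity and limits reduce to
`A ⊗ I`. -/
theorem inner_symTensorId {p m : ℕ} (b : SymPow Z p →L[ℂ] SymPow Z p) (f : SymPow Z (p + m)) :
    ⟪f, symTensorId rfl b f⟫_ℂ
      = ⟪(f : TensorPow Z (p + m)), tensorId rfl (extendSym b) (f : TensorPow Z (p + m))⟫_ℂ := by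
  rw [symTensorId_apply]
  exact Submodule.inner_orthogonalProjectionOnto_eq_of_mem_left _ _

theorem norm_symTensorId_le {p m : ℕ} (b : SymPow Z p →L[ℂ] SymPow Z p) :
    ‖symTensorId (rfl : p + m = p + m) b‖ ≤ ‖b‖ := by
  refine ContinuousLinearMap.opNorm_le_bound _ (norm_nonneg b) fun f => ?_
  rw [symTensorId_apply]
  refine (norm_symProj_apply_le _).trans ((norm_tensorId_apply_le _ _).trans ?_)
  exact mul_le_mul_of_nonneg_right (norm_extendSym_le b) (norm_nonneg _)

open scoped ComplexOrder in
theorem inner_symTensorId_nonneg {p m : ℕ} {b : SymPow Z p →L[ℂ] SymPow Z p} (hb : b.IsPositive)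
    (f : SymPow Z (p + m)) : 0 ≤ ⟪f, symTensorId rfl b f⟫_ℂ := by
  rw [inner_symTensorId, inner_tensorId_of_isPositive (extendSym_isPositive hb)]
  exact Complex.zero_le_real.2 (by positivity)

/-- The source of normality of the Wick functional: `b ∘ finProj s` tends strongly to `b` with norms
at most `‖b‖`. -/
theorem tendsto_inner_symTensorId {p m : ℕ} (b : SymPow Z p →L[ℂ] SymPow Z p)
    (f : SymPow Z (p + m)) :
    Tendsto (fun s => ⟪f, symTensorId rfl (b ∘L finProj (SymPow Z p) s) f⟫_ℂ) atTop
      (𝓝 ⟪f, symTensorId rfl b f⟫_ℂ) := by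
  simp only [inner_symTensorId]
  refine tendsto_const_nhds.inner (tendsto_tensorId (C := ‖b‖) (fun g => ?_) (fun s => ?_) _)
  · exact (((SymPow Z p).subtypeL ∘L b).continuous.tendsto _).comp (tendsto_finProj (symProj p g))
  · refine (norm_extendSym_le _).trans ((ContinuousLinearMap.opNorm_comp_le _ _).trans ?_)
    exact mul_le_of_le_one_right (norm_nonneg _) (norm_finProj_le s)

end SymTensorId

theorem tsum_norm_sq_comp_le {E F : Type*} [NormedAddCommGroup E] [InnerProductSpace ℂ E]
    [CompleteSpace E] [NormedAddCommGroup F] [InnerProductSpace ℂ F]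
    [CompleteSpace F] {ι κ : Type*} (e : HilbertBasis ι ℂ E) (f : HilbertBasis κ ℂ F)
    {A : E →L[ℂ] F} (hA : Summable fun i => ‖A (e i)‖ ^ 2) (b : E →L[ℂ] E) :
    ∑' i, ‖A (b (e i))‖ ^ 2 ≤ ‖b‖ ^ 2 * ∑' i, ‖A (e i)‖ ^ 2 := by
  have h1 := hasSum_norm_sq_adjoint e f (A ∘L b) (summable_norm_sq_comp e f hA b).hasSum
  have h2 := (hasSum_norm_sq_adjoint e f A hA.hasSum).mul_left (‖b‖ ^ 2)
  refine hasSum_le (fun j => ?_) h1 h2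
  rw [ContinuousLinearMap.adjoint_comp, ← mul_pow]
  refine pow_le_pow_left₀ (norm_nonneg _) ?_ 2
  refine ((ContinuousLinearMap.adjoint b).le_opNorm _).trans_eq ?_
  rw [LinearIsometryEquiv.norm_map]
  rfl

section SqrtOp

variable {E : Type*} [NormedAddCommGroup E] [InnerProductSpace ℂ E] [CompleteSpace E]

/-- The square root of a positive operator. -/
def sqrtOp (γ : E →L[ℂ] E) : E →L[ℂ] E := CFC.sqrt γ

theorem inner_sqrtOp {γ : E →L[ℂ] E} (hγ : γ.IsPositive) (x y : E) :
    ⟪sqrtOp γ x, sqrtOp γ y⟫_ℂ = ⟪x, γ y⟫_ℂ :=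
  inner_sqrt_sqrt hγ x y

theorem norm_sqrtOp_sq {γ : E →L[ℂ] E} (hγ : γ.IsPositive) (x : E) :
    ‖sqrtOp γ x‖ ^ 2 = (⟪x, γ x⟫_ℂ).re :=
  norm_sqrt_sq hγ x

end SqrtOp

/-! ### The trace functional on one particle sector -/

section Block

variable {Z : Type*} [NormedAddCommGroup Z] [InnerProductSpace ℂ Z]
  {F : Type*} [NormedAddCommGroup F] [InnerProductSpace ℂ F] [CompleteSpace F]
  -- A Wick block goes from `⋁ⁿ Z` to `⋁^(p+(n-p)) Z`, which is `⋁ⁿ Z` only through the proof `h`. A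
  -- family `A` over all degrees avoids casts; `subst h` identifies the two degrees when needed.
  (A : ∀ n, SymPow Z n →L[ℂ] F) {p m n : ℕ} (h : p + m = n)

/-- The functional `b ↦ ⟪A* v, (b ∨ I) A* v⟫` attached to an operator `A` on `⋁ⁿ Z`. -/
def blockForm (v : F) (b : SymPow Z p →L[ℂ] SymPow Z p) : ℂ :=
  ⟪ContinuousLinearMap.adjoint (A (p + m)) v,
    symTensorId h b (ContinuousLinearMap.adjoint (A n) v)⟫_ℂ

theorem blockForm_add (v : F) (b b' : SymPow Z p →L[ℂ] SymPow Z p) :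
    blockForm A h v (b + b') = blockForm A h v b + blockForm A h v b' := by
  simp only [blockForm, symTensorId_add, add_apply, inner_add_right]

theorem blockForm_smul (v : F) (c : ℂ) (b : SymPow Z p →L[ℂ] SymPow Z p) :
    blockForm A h v (c • b) = c * blockForm A h v b := by
  simp only [blockForm, symTensorId_smul, smul_apply, inner_smul_right]

theorem norm_blockForm_le (v : F) (b : SymPow Z p →L[ℂ] SymPow Z p) :
    ‖blockForm A h v b‖ ≤ ‖b‖ * ‖ContinuousLinearMap.adjoint (A n) v‖ ^ 2 := by
  subst h
  exact (norm_inner_apply_le _ _).trans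
    (mul_le_mul_of_nonneg_right (norm_symTensorId_le b) (by positivity))

open scoped ComplexOrder in
theorem blockForm_nonneg (v : F) {b : SymPow Z p →L[ℂ] SymPow Z p} (hb : b.IsPositive) :
    0 ≤ blockForm A h v b := by
  subst h
  exact inner_symTensorId_nonneg hb _

theorem tendsto_blockForm (v : F) (b : SymPow Z p →L[ℂ] SymPow Z p) :
    Tendsto (fun s => blockForm A h v (b ∘L finProj (SymPow Z p) s)) atTop
      (𝓝 (blockForm A h v b)) := by
  subst h
  exact tendsto_inner_symTensorId b _

variable {κ : Type*} (f : HilbertBasis κ ℂ F)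

include f in
-- Each term is at most a sum of two squares, and the Hilbert-Schmidt ideal bound controls the
-- second; hence the factor `1 + ‖b‖²`.
theorem summable_norm_block (b : SymPow Z p →L[ℂ] SymPow Z p)
    (hA : Summable fun j => ‖A n (hbasis (SymPow Z n) j)‖ ^ 2) :
    (Summable fun j => ‖⟪A n (hbasis (SymPow Z n) j),
      A (p + m) (symTensorId h b (hbasis (SymPow Z n) j))⟫_ℂ‖) ∧
    ∑' j, ‖⟪A n (hbasis (SymPow Z n) j),
      A (p + m) (symTensorId h b (hbasis (SymPow Z n) j))⟫_ℂ‖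
      ≤ (1 + ‖b‖ ^ 2) * ∑' j, ‖A n (hbasis (SymPow Z n) j)‖ ^ 2 := by
  subst h
  set e := hbasis (SymPow Z (p + m))
  set X := symTensorId (rfl : p + m = p + m) b
  have h1 := summable_norm_sq_comp e f hA X
  have h2 := tsum_norm_sq_comp_le e f hA X
  have h3 : ∀ j, ‖⟪A (p + m) (e j), A (p + m) (X (e j))⟫_ℂ‖
      ≤ ‖A (p + m) (e j)‖ ^ 2 + ‖A (p + m) (X (e j))‖ ^ 2 := fun j => by
    refine (norm_inner_le_norm _ _).trans ?_
    nlinarith [sq_nonneg (‖A (p + m) (e j)‖ - ‖A (p + m) (X (e j))‖),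
      sq_nonneg (‖A (p + m) (e j)‖), sq_nonneg (‖A (p + m) (X (e j))‖)]
  have h4 : Summable fun j => ‖⟪A (p + m) (e j), A (p + m) (X (e j))⟫_ℂ‖ :=
    Summable.of_nonneg_of_le (fun _ => norm_nonneg _) h3 (hA.add h1)
  refine ⟨h4, (h4.tsum_le_tsum h3 (hA.add h1)).trans ?_⟩
  rw [hA.tsum_add h1, add_mul, one_mul]
  have h5 : ‖X‖ ^ 2 ≤ ‖b‖ ^ 2 := pow_le_pow_left₀ (norm_nonneg X) (norm_symTensorId_le b) 2
  have h6 : 0 ≤ ∑' j, ‖A (p + m) (e j)‖ ^ 2 := tsum_nonneg fun _ => by positivity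
  exact add_le_add le_rfl (h2.trans (mul_le_mul_of_nonneg_right h5 h6))

/-- Cyclicity again: the trace over `⋁ⁿ Z` becomes a sum over a basis of `F` of forms that are
nonnegative for positive `b`. -/
theorem hasSum_block (b : SymPow Z p →L[ℂ] SymPow Z p)
    (hA : Summable fun j => ‖A n (hbasis (SymPow Z n) j)‖ ^ 2) :
    HasSum (fun j => ⟪A n (hbasis (SymPow Z n) j),
      A (p + m) (symTensorId h b (hbasis (SymPow Z n) j))⟫_ℂ) (∑' k, blockForm A h (f k) b) := by
  subst h
  have h1 := hasSum_inner_adjoint (hbasis (SymPow Z (p + m))) f (A (p + m))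
    (A (p + m) ∘L symTensorId rfl b) hA (summable_norm_sq_comp _ f hA _)
  simp only [ContinuousLinearMap.adjoint_comp, ContinuousLinearMap.comp_apply,
    ContinuousLinearMap.adjoint_inner_left (symTensorId rfl b)] at h1
  exact h1

end Block

/-! ### The Wick functional and its density -/

section Wick

variable {Z : Type*} [NormedAddCommGroup Z] [InnerProductSpace ℂ Z]

/-- The inclusion of the `n`-particle space in the Fock space. -/
def fockIncl (n : ℕ) : SymPow Z n →L[ℂ] Fock Z :=
  lp.singleContinuousLinearMap ℂ (fun n => SymPow Z n) 2 n

theorem toFock_lof (n : ℕ) (x : SymPow Z n) :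
    toFock (DirectSum.lof ℂ ℕ (fun n => SymPow Z n) n x) = fockIncl n x := by
  rw [toFock, DirectSum.toModule_lof]
  rfl

/-- The numerical coefficient of a Wick monomial of bidegree `(p, p)` on `⋁ⁿ Z`. -/
def wickCoeff (ε : ℝ) (p n : ℕ) : ℝ :=
  √(n.factorial * (p + (n - p)).factorial) / (n - p).factorial * √ε ^ (p + p)

theorem wickCoeff_nonneg (ε : ℝ) (p n : ℕ) : 0 ≤ wickCoeff ε p n := by
  unfold wickCoeff
  positivity

/-- In bidegree `(p, p)` the coefficient is `εᵖ n (n-1) ⋯ (n-p+1)`. This is how the number moment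
comes to dominate Wick monomials. -/
theorem wickCoeff_le {ε : ℝ} (hε : 0 ≤ ε) {p n : ℕ} (h : p ≤ n) :
    wickCoeff ε p n ≤ (ε * n) ^ p := by
  rw [wickCoeff, Nat.add_sub_cancel' h, Real.sqrt_mul_self (by positivity), ← two_mul, pow_mul,
    Real.sq_sqrt hε, mul_pow, mul_comm]
  refine mul_le_mul_of_nonneg_left ?_ (by positivity)
  rw [div_le_iff₀ (by positivity), ← Nat.factorial_mul_descFactorial h, mul_comm]
  push_cast
  refine mul_le_mul_of_nonneg_right ?_ (by positivity)
  exact_mod_cast Nat.descFactorial_le_pow n p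

theorem wickMonomial_lof (ε : ℝ) {p n : ℕ} (h : p ≤ n) (b : SymPow Z p →L[ℂ] SymPow Z p)
    (x : SymPow Z n) :
    toFock (wickMonomial ε b (DirectSum.lof ℂ ℕ (fun n => SymPow Z n) n x))
      = (wickCoeff ε p n : ℂ) •
        fockIncl (p + (n - p)) (symTensorId (Nat.add_sub_cancel' h) b x) := by
  rw [wickMonomial, DirectSum.toModule_lof, dif_pos h, LinearMap.smul_apply, map_smul,
    LinearMap.comp_apply, toFock_lof]
  rfl

theorem wickMonomial_lof_of_lt (ε : ℝ) {p n : ℕ} (h : ¬ p ≤ n)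
    (b : SymPow Z p →L[ℂ] SymPow Z p) (x : SymPow Z n) :
    wickMonomial ε b (DirectSum.lof ℂ ℕ (fun n => SymPow Z n) n x) = 0 := by
  rw [wickMonomial, DirectSum.toModule_lof, dif_neg h]
  rfl

/-- The square root of `ρ` restricted to the `n`-particle space. -/
def sqrtBlock (ρ : Fock Z →L[ℂ] Fock Z) (n : ℕ) : SymPow Z n →L[ℂ] Fock Z :=
  sqrtOp ρ ∘L fockIncl n

variable {ρ : Fock Z →L[ℂ] Fock Z} {ε : ℝ} {p : ℕ}

theorem norm_sqrtBlock_sq (hρ : ρ.IsPositive) (i : Σ n, BasisIndex (SymPow Z n)) :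
    ‖sqrtBlock ρ i.1 (hbasis (SymPow Z i.1) i.2)‖ ^ 2
      = (⟪toFock (fockBasis i), ρ (toFock (fockBasis i))⟫_ℂ).re := by
  rw [fockBasis, toFock_lof, ← norm_sqrtOp_sq hρ]
  rfl

theorem summable_numberMoment (hρ : ρ.IsPositive) (hε : 0 < ε) (hm : numberMoment ε p ρ < ∞) :
    Summable fun i : Σ n, BasisIndex (SymPow Z n) =>
      (ε * i.1) ^ p * ‖sqrtBlock ρ i.1 (hbasis (SymPow Z i.1) i.2)‖ ^ 2 := by
  refine (ENNReal.summable_toReal hm.ne).congr fun i => ?_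
  rw [← norm_sqrtBlock_sq hρ, ENNReal.toReal_ofReal (by positivity)]

/-- The contribution of the vector `v` and of the `n`-particle space to `Tr[ρ b^Wick]`. -/
def wickTerm (ρ : Fock Z →L[ℂ] Fock Z) (ε : ℝ) (p n : ℕ) (v : Fock Z)
    (b : SymPow Z p →L[ℂ] SymPow Z p) : ℂ :=
  if h : p ≤ n then
    wickCoeff ε p n * blockForm (sqrtBlock ρ) (Nat.add_sub_cancel' h) v b
  else 0

theorem norm_wickTerm_le (hε : 0 ≤ ε) (n : ℕ) (v : Fock Z) (b : SymPow Z p →L[ℂ] SymPow Z p) :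
    ‖wickTerm ρ ε p n v b‖
      ≤ (ε * n) ^ p * ‖ContinuousLinearMap.adjoint (sqrtBlock ρ n) v‖ ^ 2 * ‖b‖ := by
  rw [wickTerm]
  split_ifs with h
  · rw [norm_mul, Complex.norm_real, Real.norm_of_nonneg (wickCoeff_nonneg _ _ _), mul_assoc,
      mul_comm _ ‖b‖]
    exact mul_le_mul (wickCoeff_le hε h) (norm_blockForm_le _ _ _ _) (norm_nonneg _)
      (by positivity)
  · rw [norm_zero]
    positivity

theorem wickTerm_add (n : ℕ) (v : Fock Z) (b b' : SymPow Z p →L[ℂ] SymPow Z p) :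
    wickTerm ρ ε p n v (b + b') = wickTerm ρ ε p n v b + wickTerm ρ ε p n v b' := by
  unfold wickTerm
  split_ifs
  · rw [blockForm_add, mul_add]
  · rw [add_zero]

theorem wickTerm_smul (n : ℕ) (v : Fock Z) (c : ℂ) (b : SymPow Z p →L[ℂ] SymPow Z p) :
    wickTerm ρ ε p n v (c • b) = c * wickTerm ρ ε p n v b := by
  unfold wickTerm
  split_ifs
  · rw [blockForm_smul]
    ring
  · rw [mul_zero]

open scoped ComplexOrder in
theorem wickTerm_nonneg (n : ℕ) (v : Fock Z) {b : SymPow Z p →L[ℂ] SymPow Z p}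
    (hb : b.IsPositive) : 0 ≤ wickTerm ρ ε p n v b := by
  unfold wickTerm
  split_ifs
  · exact mul_nonneg (Complex.zero_le_real.2 (wickCoeff_nonneg _ _ _)) (blockForm_nonneg _ _ _ hb)
  · exact le_rfl

theorem tendsto_wickTerm (n : ℕ) (v : Fock Z) (b : SymPow Z p →L[ℂ] SymPow Z p) :
    Tendsto (fun s => wickTerm ρ ε p n v (b ∘L finProj (SymPow Z p) s)) atTop
      (𝓝 (wickTerm ρ ε p n v b)) := by
  unfold wickTerm
  split_ifs
  · exact (tendsto_blockForm _ _ v b).const_mul _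
  · exact tendsto_const_nhds

theorem pow_pos_of_le (hε : 0 < ε) {n : ℕ} (h : p ≤ n) : 0 < (ε * n) ^ p := by
  -- At `n = 0` also `p = 0`, and the weight is `0 ^ 0 = 1`.
  rcases Nat.eq_zero_or_pos n with rfl | hn
  · obtain rfl : p = 0 := by omega
    simp
  · positivity

theorem summable_sqrtBlock (hρ : ρ.IsPositive) (hε : 0 < ε) (hm : numberMoment ε p ρ < ∞)
    {n : ℕ} (h : p ≤ n) :
    Summable fun j => ‖sqrtBlock ρ n (hbasis (SymPow Z n) j)‖ ^ 2 := by
  have h1 := (summable_numberMoment hρ hε hm).sigma_factor n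
  exact (summable_mul_left_iff (pow_pos_of_le hε h).ne').1 h1

theorem summable_wickTerm_bound (hρ : ρ.IsPositive) (hε : 0 < ε) (hm : numberMoment ε p ρ < ∞) :
    Summable fun i : ℕ × BasisIndex (Fock Z) => (ε * i.1) ^ p *
      ‖ContinuousLinearMap.adjoint (sqrtBlock ρ i.1) (hbasis (Fock Z) i.2)‖ ^ 2 := by
  have h0 := summable_numberMoment hρ hε hm
  have h2 := (summable_sigma_of_nonneg fun i => by positivity).1 h0
  have h1 : ∀ n : ℕ, HasSum (fun k => (ε * n) ^ p *
      ‖ContinuousLinearMap.adjoint (sqrtBlock ρ n) (hbasis (Fock Z) k)‖ ^ 2)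
      (∑' j, (ε * n) ^ p * ‖sqrtBlock ρ n (hbasis (SymPow Z n) j)‖ ^ 2) := fun n => by
    -- If the weight vanishes, the moment says nothing about the block, but all the weighted terms
    -- are zero.
    rcases (by positivity : 0 ≤ (ε * n) ^ p).eq_or_lt with h | h
    · simp only [← h, zero_mul, tsum_zero]
      exact hasSum_zero
    · rw [tsum_mul_left]
      have h3 : Summable fun j => ‖sqrtBlock ρ n (hbasis (SymPow Z n) j)‖ ^ 2 :=
        (summable_mul_left_iff h.ne').1 (h2.1 n)
      exact (hasSum_norm_sq_adjoint (hbasis (SymPow Z n)) (hbasis (Fock Z)) (sqrtBlock ρ n)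
        h3.hasSum).mul_left _
  rw [summable_prod_of_nonneg fun i => by positivity]
  refine ⟨fun n => (h1 n).summable, ?_⟩
  simpa only [(h1 _).tsum_eq] using h2.2

/-- Cyclicity is applied in each particle sector. The number moment makes both families absolutely
summable, which justifies regrouping them by `n`. -/
theorem traceMul_wickMonomial (hρ : ρ.IsPositive) (hε : 0 < ε) (hm : numberMoment ε p ρ < ∞)
    (b : SymPow Z p →L[ℂ] SymPow Z p) :
    traceMul ρ (wickMonomial ε b)
      = ∑' i : ℕ × BasisIndex (Fock Z), wickTerm ρ ε p i.1 (hbasis (Fock Z) i.2) b := by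
  have hterm : ∀ {n : ℕ} (h : p ≤ n) (j : BasisIndex (SymPow Z n)),
      ⟪toFock (fockBasis ⟨n, j⟩), ρ (toFock (wickMonomial ε b (fockBasis ⟨n, j⟩)))⟫_ℂ
        = wickCoeff ε p n * ⟪sqrtBlock ρ n (hbasis (SymPow Z n) j), sqrtBlock ρ (p + (n - p))
          (symTensorId (Nat.add_sub_cancel' h) b (hbasis (SymPow Z n) j))⟫_ℂ := fun h j => by
    rw [fockBasis, wickMonomial_lof ε h, toFock_lof, map_smul, inner_smul_right,
      ← inner_sqrtOp hρ]
    rfl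
  have hzero : ∀ {n : ℕ} (_ : ¬ p ≤ n) (j : BasisIndex (SymPow Z n)),
      ⟪toFock (fockBasis ⟨n, j⟩), ρ (toFock (wickMonomial ε b (fockBasis ⟨n, j⟩)))⟫_ℂ = 0 :=
    fun h j => by
      rw [fockBasis, wickMonomial_lof_of_lt ε h, map_zero, map_zero, inner_zero_right]
  have h0 := (summable_sigma_of_nonneg fun i => by positivity).1 (summable_numberMoment hρ hε hm)
  have hS : Summable fun i : Σ n, BasisIndex (SymPow Z n) =>
      ⟪toFock (fockBasis i), ρ (toFock (wickMonomial ε b (fockBasis i)))⟫_ℂ := by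
    refine Summable.of_norm ?_
    rw [summable_sigma_of_nonneg fun _ => norm_nonneg _]
    have key : ∀ n, (Summable fun j => ‖⟪toFock (fockBasis ⟨n, j⟩),
          ρ (toFock (wickMonomial ε b (fockBasis ⟨n, j⟩)))⟫_ℂ‖) ∧
        ∑' j, ‖⟪toFock (fockBasis ⟨n, j⟩),
          ρ (toFock (wickMonomial ε b (fockBasis ⟨n, j⟩)))⟫_ℂ‖
          ≤ (1 + ‖b‖ ^ 2) *
            ∑' j, (ε * n) ^ p * ‖sqrtBlock ρ n (hbasis (SymPow Z n) j)‖ ^ 2 := fun n => by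
      by_cases h : p ≤ n
      · simp only [hterm h, norm_mul, Complex.norm_real,
          Real.norm_of_nonneg (wickCoeff_nonneg _ _ _), tsum_mul_left]
        obtain ⟨h1, h2⟩ := summable_norm_block (sqrtBlock ρ) (Nat.add_sub_cancel' h)
          (hbasis (Fock Z)) b (summable_sqrtBlock hρ hε hm h)
        refine ⟨h1.mul_left _, ?_⟩
        rw [mul_left_comm]
        exact mul_le_mul (wickCoeff_le hε.le h) h2 (tsum_nonneg fun _ => norm_nonneg _)
          (by positivity)
      · simp only [hzero h, norm_zero, tsum_zero]
        exact ⟨summable_zero, mul_nonneg (by positivity) (tsum_nonneg fun _ => by positivity)⟩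
    exact ⟨fun n => (key n).1, Summable.of_nonneg_of_le
      (fun n => tsum_nonneg fun _ => norm_nonneg _) (fun n => (key n).2) (h0.2.mul_left _)⟩
  have hS' : Summable fun i : ℕ × BasisIndex (Fock Z) =>
      wickTerm ρ ε p i.1 (hbasis (Fock Z) i.2) b :=
    Summable.of_norm_bounded ((summable_wickTerm_bound hρ hε hm).mul_right ‖b‖)
      fun i => norm_wickTerm_le hε.le _ _ _
  rw [traceMul, hS.tsum_sigma, hS'.tsum_prod]
  refine tsum_congr fun n => ?_
  by_cases h : p ≤ n
  · simp only [hterm h, wickTerm, dif_pos h, tsum_mul_left]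
    rw [(hasSum_block (sqrtBlock ρ) (Nat.add_sub_cancel' h) (hbasis (Fock Z)) b
      (summable_sqrtBlock hρ hε hm h)).tsum_eq]
  · simp only [hzero h, wickTerm, dif_neg h, tsum_zero]

open scoped ComplexOrder in
/-- The unnormalized reduced density matrix. -/
theorem exists_density_wick (hρ : ρ.IsPositive) (hε : 0 < ε) (hm : numberMoment ε p ρ < ∞) :
    ∃ γ : SymPow Z p →L[ℂ] SymPow Z p, γ.IsPositive ∧ IsTraceClass γ ∧
      ∀ b, trace (γ ∘L b) = traceMul ρ (wickMonomial ε b) := by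
  have hw := summable_wickTerm_bound hρ hε hm
  have hS : ∀ b : SymPow Z p →L[ℂ] SymPow Z p, Summable fun i : ℕ × BasisIndex (Fock Z) =>
      wickTerm ρ ε p i.1 (hbasis (Fock Z) i.2) b := fun b =>
    Summable.of_norm_bounded (hw.mul_right ‖b‖) fun i => norm_wickTerm_le hε.le _ _ _
  let φ : (SymPow Z p →L[ℂ] SymPow Z p) →L[ℂ] ℂ := LinearMap.mkContinuous
    { toFun := fun b => ∑' i : ℕ × BasisIndex (Fock Z),
        wickTerm ρ ε p i.1 (hbasis (Fock Z) i.2) b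
      map_add' := fun b b' => by
        simp only [wickTerm_add]
        exact (hS b).tsum_add (hS b')
      map_smul' := fun c b => by
        simp only [wickTerm_smul, tsum_mul_left]
        rfl }
    _ fun b => tsum_of_norm_bounded (hw.hasSum.mul_right ‖b‖)
      fun i => norm_wickTerm_le hε.le _ _ _
  -- Positivity holds term by term; normality is dominated convergence for the series, with the
  -- moment series times `‖b‖` as majorant.
  obtain ⟨γ, h1, h2, h3⟩ := exists_density φ
    (fun x => tsum_nonneg fun i =>
      wickTerm_nonneg _ _ (InnerProductSpace.isPositive_rankOne_self x))
    fun b => by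
      refine tendsto_tsum_of_dominated_convergence (hw.mul_right ‖b‖)
        (fun i => tendsto_wickTerm i.1 _ b) (Eventually.of_forall fun s i => ?_)
      refine (norm_wickTerm_le hε.le _ _ _).trans (mul_le_mul_of_nonneg_left ?_ (by positivity))
      refine (ContinuousLinearMap.opNorm_comp_le _ _).trans ?_
      exact mul_le_of_le_one_right (norm_nonneg _) (norm_finProj_le s)
  refine ⟨γ, h1, h2, fun b => ?_⟩
  rw [traceMul_wickMonomial hρ hε hm, trace, (h3 b).tsum_eq]
  rfl

end Wick

/-! ### Existence and uniqueness of reduced density matrices -/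

section Reduced

variable {Z : Type*} [NormedAddCommGroup Z] [InnerProductSpace ℂ Z]
  {ρ : Fock Z →L[ℂ] Fock Z} {ε : ℝ} {p : ℕ}

theorem IsReducedDensity.unique {γ γ' : SymPow Z p →L[ℂ] SymPow Z p}
    (h : IsReducedDensity ε ρ p γ) (h' : IsReducedDensity ε ρ p γ') : γ = γ' :=
  eq_of_trace_comp_eq fun b => (h.2 b).trans (h'.2 b).symm

open scoped ComplexOrder in
theorem exists_isReducedDensity (hρ : ρ.IsPositive) (htr : trace ρ = 1) (hε : 0 < ε)
    (hm : numberMoment ε p ρ < ∞) :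
    ∃ γ, γ.IsPositive ∧ IsReducedDensity ε ρ p γ := by
  obtain ⟨γ, h1, h2, h3⟩ := exists_density_wick hρ hε hm
  set N := traceMul ρ (wickMonomial ε (ContinuousLinearMap.id ℂ (SymPow Z p))) with hN
  have hN0 : 0 ≤ N := by
    rw [hN, ← h3]
    exact tsum_nonneg fun i => h1.inner_nonneg_right _
  have hNre : N = (N.re : ℂ) := Complex.eq_re_of_ofReal_le (r := 0) (by simpa using hN0)
  have hre : 0 ≤ N.re := (Complex.le_def.1 hN0).1
  -- If `N = 0` the inverse is `0` by convention, and the zero operator satisfies the definition,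
  -- whose quotient is then also `0`.
  refine ⟨((N.re⁻¹ : ℝ) : ℂ) • γ,
    h1.smul_of_nonneg (Complex.zero_le_real.2 (inv_nonneg.2 hre)),
    IsTraceClass.smul_of_nonneg h1 h2 (inv_nonneg.2 hre), fun b => ?_⟩
  rw [trace_smul_comp, h3, htr, ← hN, one_div, Complex.ofReal_inv, ← hNre]

theorem isReducedDensity_reducedDensity (hρ : ρ.IsPositive) (htr : trace ρ = 1) (hε : 0 < ε)
    (hm : numberMoment ε p ρ < ∞) :
    (reducedDensity ε ρ p).IsPositive ∧ IsReducedDensity ε ρ p (reducedDensity ε ρ p) := by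
  obtain ⟨γ, h1, h2⟩ := exists_isReducedDensity hρ htr hε hm
  have h3 : IsReducedDensity ε ρ p (reducedDensity ε ρ p) := Classical.epsilon_spec ⟨γ, h2⟩
  rw [h3.unique h2]
  exact ⟨h1, h2⟩

/-- The homogeneous polynomial with kernel `b`. -/
def PolyAlg.ofKernel (b : SymPow Z p →L[ℂ] SymPow Z p) : PolyAlg Z where
  degrees := {(p, p)}
  -- Kernels are demanded in all bidegrees, so `b` is transported along the equalities; the value
  -- `0` elsewhere is never summed.
  kernel p' q' := if h : p = p' ∧ p = q' then h.1 ▸ h.2 ▸ b else 0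

theorem PolyAlg.ofKernel_kernel (b : SymPow Z p →L[ℂ] SymPow Z p) :
    (PolyAlg.ofKernel b).kernel p p = b :=
  dif_pos ⟨rfl, rfl⟩

theorem PolyAlg.ofKernel_eval (b : SymPow Z p →L[ℂ] SymPow Z p) (z : Z) :
    (PolyAlg.ofKernel b).eval z = ⟪tpow p z, b (tpow p z)⟫_ℂ := by
  rw [PolyAlg.eval, show (PolyAlg.ofKernel b).degrees = {(p, p)} from rfl, Finset.sum_singleton,
    PolyAlg.ofKernel_kernel]

theorem PolyAlg.ofKernel_wick (b : SymPow Z p →L[ℂ] SymPow Z p) :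
    (PolyAlg.ofKernel b).wick ε = wickMonomial ε b := by
  rw [PolyAlg.wick, show (PolyAlg.ofKernel b).degrees = {(p, p)} from rfl, Finset.sum_singleton,
    PolyAlg.ofKernel_kernel]

end Reduced

/-! ### The limit density matrix -/

section Limit

variable {Z : Type*} [NormedAddCommGroup Z] [InnerProductSpace ℂ Z] [MeasurableSpace Z]

theorem eq_dirac_of_compl_null {X : Type*} [MeasurableSpace X] [MeasurableSingletonClass X]
    {μ : Measure X} [IsProbabilityMeasure μ] {a : X} (h : μ {a}ᶜ = 0) : μ = Measure.dirac a := by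
  ext s hs
  rw [Measure.dirac_apply' a hs]
  by_cases ha : a ∈ s
  · rw [Set.indicator_of_mem ha, Pi.one_apply, ← prob_compl_eq_zero_iff hs]
    exact measure_mono_null (Set.compl_subset_compl.2 (Set.singleton_subset_iff.2 ha)) h
  · rw [Set.indicator_of_notMem ha]
    exact measure_mono_null (Set.subset_compl_singleton_iff.2 ha) h

omit [InnerProductSpace ℂ Z] in
-- The support of `‖z‖ ^ k` contains every `z ≠ 0`, so a zero integral would concentrate `μ` at the
-- origin.
theorem integral_norm_pow_pos [BorelSpace Z] {μ : Measure Z} [IsProbabilityMeasure μ]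
    (hμ : μ ≠ Measure.dirac 0) {k : ℕ} (h : Integrable (fun z => ‖z‖ ^ k) μ) :
    0 < ∫ z, ‖z‖ ^ k ∂μ := by
  rw [integral_pos_iff_support_of_nonneg (fun z => by positivity) h]
  refine pos_iff_ne_zero.2 fun h0 => hμ (eq_dirac_of_compl_null (measure_mono_null ?_ h0))
  intro z hz
  exact pow_ne_zero _ (norm_ne_zero_iff.2 hz)

/-- The function is the polynomial with identity kernel. -/
theorem ConditionP.integrable_norm_pow {ρ : ℝ → Fock Z →L[ℂ] Fock Z} {μ : Measure Z}
    (hP : ConditionP ρ μ) (p : ℕ) : Integrable (fun z => ‖z‖ ^ (2 * p)) μ := by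
  refine (hP.integrable (PolyAlg.ofKernel (ContinuousLinearMap.id ℂ (SymPow Z p)))).re.congr
    (ae_of_all _ fun z => ?_)
  simp only [PolyAlg.ofKernel_eval, ContinuousLinearMap.id_apply, inner_tpow]
  exact Complex.ofReal_re _

open scoped ComplexOrder in
theorem limitDensity_spec [CompleteSpace Z] [TopologicalSpace.SeparableSpace Z] [BorelSpace Z]
    {μ : Measure Z} {p : ℕ} (h : Integrable (fun z => ‖z‖ ^ (2 * p)) μ) :
    Integrable (fun z => InnerProductSpace.rankOne ℂ (tpow p z) (tpow p z)) μ ∧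
    (limitDensity μ p).IsPositive ∧ IsTraceClass (limitDensity μ p) ∧
    ∀ b, trace (limitDensity μ p ∘L b)
      = ((∫ z, ‖z‖ ^ (2 * p) ∂μ : ℝ) : ℂ)⁻¹ * ∫ z, ⟪tpow p z, b (tpow p z)⟫_ℂ ∂μ := by
  have hsep : SecondCountableTopology Z := UniformSpace.secondCountable_of_separable Z
  have hv : AEStronglyMeasurable (tpow p : Z → SymPow Z p) μ :=
    (continuous_tpow p).aestronglyMeasurable
  have h2 : Integrable (fun z => ‖tpow p z‖ ^ 2) μ := by simpa only [norm_tpow_sq] using h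
  obtain ⟨h3, h4, h5⟩ := integral_rankOne hv h2
  have hc : 0 ≤ (∫ z, ‖z‖ ^ (2 * p) ∂μ)⁻¹ :=
    inv_nonneg.2 (integral_nonneg fun z => by positivity)
  have e : limitDensity μ p = (((∫ z, ‖z‖ ^ (2 * p) ∂μ)⁻¹ : ℝ) : ℂ) •
      ∫ z, InnerProductSpace.rankOne ℂ (tpow p z) (tpow p z) ∂μ := by
    rw [limitDensity, Complex.coe_smul]
  refine ⟨integrable_rankOne hv h2, ?_, ?_, fun b => ?_⟩
  · rw [e]
    exact h3.smul_of_nonneg (Complex.zero_le_real.2 hc)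
  · rw [e]
    exact h4.smul_of_nonneg h3 hc
  · rw [e, trace_smul_comp, h5, Complex.ofReal_inv]

end Limit

end MeanField

end

/-! ### The main theorem -/

theorem proposition2 {Z : Type*} [NormedAddCommGroup Z] [InnerProductSpace ℂ Z] [CompleteSpace Z]
    [TopologicalSpace.SeparableSpace Z] [MeasurableSpace Z] [BorelSpace Z]
    (ε₀ : ℝ) (hε₀ : 0 < ε₀) (ρ : ℝ → MeanField.Fock Z →L[ℂ] MeanField.Fock Z)
    (hρ_trace_class : ∀ ε ∈ Set.Ioo 0 ε₀, MeanField.IsTraceClass (ρ ε))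
    (hρ_nonneg : ∀ ε ∈ Set.Ioo 0 ε₀, (ρ ε).IsPositive)
    (hρ_trace : ∀ ε ∈ Set.Ioo 0 ε₀, MeanField.trace (ρ ε) = 1)
    (μ : Measure Z) (hμ : MeanField.wignerMeasures ε₀ ρ = {μ})
    (hP : MeanField.ConditionP ρ μ) (hμ0 : μ ≠ Measure.dirac 0) (p : ℕ) :
    (Integrable (fun z => ‖z‖ ^ (2 * p)) μ ∧ 0 < ∫ z, ‖z‖ ^ (2 * p) ∂μ ∧
      Integrable (fun z => InnerProductSpace.rankOne ℂ (MeanField.tpow p z) (MeanField.tpow p z)) μ ∧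
      MeanField.IsTraceClass (MeanField.limitDensity μ p)) ∧
    (∀ᶠ ε in 𝓝[>] (0 : ℝ), ∃! γ, MeanField.IsReducedDensity ε (ρ ε) p γ) ∧
    Tendsto (fun ε => MeanField.traceNorm
        (MeanField.reducedDensity ε (ρ ε) p - MeanField.limitDensity μ p))
      (𝓝[>] (0 : ℝ)) (𝓝 0) := by
  open MeanField in
  have hprob : IsProbabilityMeasure μ :=
    (hμ ▸ Set.mem_singleton μ : μ ∈ wignerMeasures ε₀ ρ).1
  have hint := hP.integrable_norm_pow p
  have hpos := integral_norm_pow_pos hμ0 hint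
  obtain ⟨h1, h2, h3, h4⟩ := limitDensity_spec hint
  have hev : ∀ᶠ ε in 𝓝[>] (0 : ℝ), (reducedDensity ε (ρ ε) p).IsPositive ∧
      IsReducedDensity ε (ρ ε) p (reducedDensity ε (ρ ε) p) ∧ trace (ρ ε) = 1 := by
    filter_upwards [hP.moments p, Ioo_mem_nhdsGT hε₀] with ε hm hε
    obtain ⟨h5, h6⟩ := isReducedDensity_reducedDensity (hρ_nonneg ε hε) (hρ_trace ε hε) hε.1 hm
    exact ⟨h5, h6, hρ_trace ε hε⟩
  have hlim : ∀ b : SymPow Z p →L[ℂ] SymPow Z p,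
      Tendsto (fun ε => traceMul (ρ ε) (wickMonomial ε b)) (𝓝[>] (0 : ℝ))
        (𝓝 (∫ z, ⟪tpow p z, b (tpow p z)⟫_ℂ ∂μ)) := fun b => by
    simpa only [PolyAlg.ofKernel_wick, PolyAlg.ofKernel_eval] using
      hP.tendsto (PolyAlg.ofKernel b)
  -- The identity kernel gives the limit of the normalizations, `∫ ‖z‖ ^ (2 * p) dμ`; by `hpos` it
  -- can be inverted in `htr`.
  have hone := hlim (ContinuousLinearMap.id ℂ (SymPow Z p))
  simp only [ContinuousLinearMap.id_apply, inner_tpow] at hone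
  rw [integral_complex_ofReal] at hone
  have htr : ∀ b : SymPow Z p →L[ℂ] SymPow Z p,
      Tendsto (fun ε => trace (reducedDensity ε (ρ ε) p ∘L b)) (𝓝[>] (0 : ℝ))
        (𝓝 (trace (limitDensity μ p ∘L b))) := fun b => by
    rw [h4]
    refine ((hone.inv₀ (Complex.ofReal_ne_zero.2 hpos.ne')).mul (hlim b)).congr' ?_
    filter_upwards [hev] with ε hε
    rw [hε.2.1.2 b, hε.2.2, one_div]
  refine ⟨⟨hint, hpos, h1, h3⟩, ?_, ?_⟩
  · filter_upwards [hev] with ε hε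
    exact ⟨_, hε.2.1, fun γ hγ => hγ.unique hε.2.1⟩
  -- The identity kernel supplies convergence of traces, and the rank-one kernels supply weak
  -- convergence.
  · refine tendsto_traceNorm_sub (hev.mono fun ε hε => hε.1) (hev.mono fun ε hε => hε.2.1.1)
      h2 h3 (fun x y => ?_) (htr (ContinuousLinearMap.id ℂ (SymPow Z p)))
    simpa only [trace_rankOne] using htr (InnerProductSpace.rankOne ℂ x y)
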